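/- Let $G\subset\mathbb R^d$ be a bounded domain with $\partial G\in C^{4,\epsilon}$ for some $\epsilon\in(0,1)$, let $\nu$ be the inward unit normal on $\partial G$, and let $T>0$. Write $C^{\frac{p+\epsilon}{2},p+\epsilon}$ for the parabolic Hölder spaces. Let $b:[0,T]\times\bar G\to\mathbb R^d$, $\sigma:[0,T]\times\bar G\to\mathbb R^{d\times d}$ and $c,g:[0,T]\times\bar G\to\mathbb R$ be of class $C^{1+\epsilon/2,2+\epsilon}([0,T]\times\bar G)$; let $\gamma,\psi\in C^{1+\epsilon/2,2+\epsilon}([0,T]\times\partial G)$, $\mu\in C^{2+\epsilon}(\partial G)$ with $\mu>0$ on $\partial G$, and $\varphi\in C^{4+\epsilon}(\bar G)$, where $\varphi$ is also extended to a locally Lipschitz function on $\mathbb R^d$. (Hölder functions on $\partial G$ are restrictions of Hölder functions on $\bar G$.) Put $a=\sigma\sigma^\top$ and $\mathcal A u=\frac12\sum_{i,j}a^{ij}\partial_{x^i}\partial_{x^j}u+\sum_i b^i\partial_{x^i}u$. Suppose that $u\in C^{2+\epsilon/2,4+\epsilon}([0,T]\times\bar G)$ solves the sticky boundary value problem $$\partial_t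 u+\mathcal A u+cu+g=0\ \text{ on }[0,T]\times\bar G,\qquad u(T,\cdot)=\varphi\ \text{ on }\bar G,$$ $$-\mu\,\mathcal A u+\partial_\nu u+\gamma u=\psi\ \text{ on }[0,T]\times\partial G .$$ Let $t_0\in[0,T)$ and $X_0=x\in G$. For $h\in(0,1)$ the projected Euler scheme is the following Markov chain $(t_k,X_k,Y_k,Z_k)$, started at $(t_0,x,1,0)$. Let $\xi_k^i$ ($k\ge1$, $1\le i\le d$) be independent random variables with values $\pm1$, each with probability $1/2$. As long as $t_k\le T$: * if $X_k\in\bar G$, then $t_{k+1}=t_k+h$, $X_{k+1}=X_k+h\,b(t_k,X_k)+h^{1/2}\sigma(t_k,X_k)\xi_{k+1}$, $Y_{k+1}=Y_k+h\,c(t_k,X_k)Y_k$, $Z_{k+1}=Z_k+h\,g(t_k,X_k)Y_k$; * if $X_k\notin\bar G$, then with $r_k=\mathrm{dist}(X_k,\partial G)$ and $X_{k+1}$ the projection of $X_k$ on $\partial G$ (a point of $\partial G$ at distance $r_k$ from $X_k$; it is unique if $h$ is small), $t_{k+1}=t_k+r_k\mu(X_{k+1})$, $Y_{k+1}=Y_k+r_k\gamma(t_k,X_{k+1})Y_k+r_k\mu(X_{k+1})c(t_k,X_{k+1})Y_k$,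 $Z_{k+1}=Z_k-r_k\psi(t_k,X_{k+1})Y_k+r_k\mu(X_{k+1})g(t_k,X_{k+1})Y_k$. The scheme stops at the first index $\chi$ with $t_\chi>T$. Then the scheme always terminates, $\varphi(X_\chi)Y_\chi+Z_\chi$ is integrable, and there is a constant $C>0$ independent of $h$ such that for all $h\in(0,1)$ $$\big|\mathbb E\big(\varphi(X_\chi)Y_\chi+Z_\chi\big)-u(t_0,X_0)\big|\le C\,h^{1/2}.$$ -/

import Mathlib

open MeasureTheory ProbabilityTheory Set
open scoped NNReal

noncomputable section

namespace StickyEuler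

/-- `d`-dimensional Euclidean space. -/
abbrev Space (d : ℕ) : Type := EuclideanSpace ℝ (Fin d)

/-! ### Hölder spaces -/

/-- The Hölder space `C^{p+ε}(closure G)`: the derivatives up to order `p` exist and are continuous
up to the boundary, and the `p`-th derivative is `ε`-Hölder. (Bounds on the derivatives are
automatic on bounded `G`.) -/
structure MemHolder {d : ℕ} (G : Set (Space d)) (p : ℕ) (ε : ℝ≥0) (f : Space d → ℝ) : Prop where
  contDiffOn : ContDiffOn ℝ p f (closure G)
  holder : ∃ C : ℝ≥0, HolderOnWith C ε (iteratedFDerivWithin ℝ p f (closure G)) (closure G)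

/-- The Hölder space `C^{p+ε}(∂G)`: restrictions to `∂G` of functions in `C^{p+ε}(closure G)`. -/
def MemHolderBoundary {d : ℕ} (G : Set (Space d)) (p : ℕ) (ε : ℝ≥0) (f : Space d → ℝ) : Prop :=
  ∃ F : Space d → ℝ, MemHolder G p ε F ∧ EqOn F f (frontier G)

/-- The mixed derivative `∂_t^i D_x^j u (t, x)` on `[0,T] × closure G` (one-sided at the boundary),
a `j`-linear form on `ℝ^d`. -/
def mixedDeriv {d : ℕ} (T : ℝ) (G : Set (Space d)) (i j : ℕ) (u : ℝ → Space d → ℝ)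
    (t : ℝ) (x : Space d) : ContinuousMultilinearMap ℝ (fun _ : Fin j => Space d) ℝ :=
  iteratedFDerivWithin ℝ j
    (fun y => iteratedDerivWithin i (fun s => u s y) (Icc 0 T) t) (closure G) x

/-- The parabolic Hölder space `C^{(p+ε)/2, p+ε}` on `[0,T] × closure G`: the derivatives
`∂_t^i D_x^j u` with `2i + j ≤ p` exist and are continuous on `[0,T] × closure G`, those with
`2i + j = p` are `ε`-Hölder in `x`, and those with `p + ε - 2i - j < 2` are
`(p + ε - 2i - j)/2`-Hölder in `t`. -/
structure MemParabolicHolder {d : ℕ} (T : ℝ) (G : Set (Space d)) (p : ℕ) (ε : ℝ≥0)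
    (u : ℝ → Space d → ℝ) : Prop where
  contDiffOn_time : ∀ x ∈ closure G, ContDiffOn ℝ (p / 2 : ℕ) (fun s => u s x) (Icc 0 T)
  contDiffOn_space : ∀ i : ℕ, 2 * i ≤ p → ∀ t ∈ Icc 0 T,
    ContDiffOn ℝ (p - 2 * i : ℕ)
      (fun y => iteratedDerivWithin i (fun s => u s y) (Icc 0 T) t) (closure G)
  continuousOn : ∀ i j : ℕ, 2 * i + j ≤ p →
    ContinuousOn (fun q : ℝ × Space d => mixedDeriv T G i j u q.1 q.2) (Icc 0 T ×ˢ closure G)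
  holder_space : ∀ i j : ℕ, 2 * i + j = p →
    ∃ C : ℝ≥0, ∀ t ∈ Icc 0 T, HolderOnWith C ε (fun x => mixedDeriv T G i j u t x) (closure G)
  holder_time : ∀ i j : ℕ, 2 * i + j ≤ p → p ≤ 2 * i + j + 1 →
    ∃ C : ℝ≥0, ∀ x ∈ closure G,
      HolderOnWith C ((((p - (2 * i + j) : ℕ) : ℝ≥0) + ε) / 2)
        (fun t => mixedDeriv T G i j u t x) (Icc 0 T)

/-- The parabolic Hölder space `C^{(p+ε)/2, p+ε}` on `[0,T] × ∂G`: restrictions of functions in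
the corresponding space on `[0,T] × closure G`. -/
def MemParabolicHolderBoundary {d : ℕ} (T : ℝ) (G : Set (Space d)) (p : ℕ) (ε : ℝ≥0)
    (v : ℝ → Space d → ℝ) : Prop :=
  ∃ V : ℝ → Space d → ℝ, MemParabolicHolder T G p ε V ∧
    ∀ t ∈ Icc 0 T, ∀ z ∈ frontier G, V t z = v t z

/-! ### Boundary regularity and the inward normal -/

/-- `ρ` is a `C^1` local defining function of `G` on the open set `U`:
`G ∩ U = {y ∈ U | 0 < ρ y}` and the gradient of `ρ` does not vanish on `U`. -/
structure IsLocalDefiningFunction {d : ℕ} (G U : Set (Space d)) (ρ : Space d → ℝ) : Prop where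
  isOpen : IsOpen U
  contDiffOn : ContDiffOn ℝ 1 ρ U
  gradient_ne_zero : ∀ y ∈ U, gradient ρ y ≠ 0
  mem_iff : ∀ y ∈ U, (y ∈ G ↔ 0 < ρ y)

/-- `∂G` is of class `C^{k,ε}`: near each boundary point, `G` is the positivity set of a
`C^{k,ε}` function with non-vanishing gradient. -/
def HasHolderBoundary {d : ℕ} (k : ℕ) (ε : ℝ≥0) (G : Set (Space d)) : Prop :=
  ∀ z ∈ frontier G, ∃ U : Set (Space d), ∃ ρ : Space d → ℝ,
    z ∈ U ∧ IsLocalDefiningFunction G U ρ ∧ ContDiffOn ℝ k ρ U ∧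
      ∃ C : ℝ≥0, HolderOnWith C ε (iteratedFDeriv ℝ k ρ) U

/-- `v` is the inward unit normal to `∂G` at `z`. -/
def IsInwardUnitNormal {d : ℕ} (G : Set (Space d)) (z v : Space d) : Prop :=
  ∃ U : Set (Space d), ∃ ρ : Space d → ℝ,
    z ∈ U ∧ IsLocalDefiningFunction G U ρ ∧ v = ‖gradient ρ z‖⁻¹ • gradient ρ z

/-! ### The sticky boundary value problem -/

/-- The data of the sticky boundary value problem (with reflection coefficient `ϱ ≡ 1`). -/
structure Problem (d : ℕ) where
  /-- terminal time -/
  T : ℝ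
  /-- spatial domain -/
  G : Set (Space d)
  /-- drift -/
  b : ℝ → Space d → Space d
  /-- diffusion matrix -/
  σ : ℝ → Space d → Matrix (Fin d) (Fin d) ℝ
  /-- zeroth order coefficient -/
  c : ℝ → Space d → ℝ
  /-- source term -/
  g : ℝ → Space d → ℝ
  /-- coefficient of stickiness -/
  μ : Space d → ℝ
  /-- absorption coefficient on the boundary -/
  γ : ℝ → Space d → ℝ
  /-- boundary data -/
  ψ : ℝ → Space d → ℝ
  /-- terminal data; outside `closure G` this is an extension of it -/
  φ : Space d → ℝ

variable {d : ℕ}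

/-- The assumptions on the domain and on the coefficients. The numerical scheme may end at a point
slightly outside `closure G`, where `φ` is evaluated as well, so `φ` is a locally Lipschitz
function on the whole space whose restriction to `closure G` is the terminal datum. -/
structure Problem.IsAdmissible (P : Problem d) (ε : ℝ≥0) : Prop where
  T_pos : 0 < P.T
  isOpen : IsOpen P.G
  isConnected : IsConnected P.G
  isBounded : Bornology.IsBounded P.G
  boundary : HasHolderBoundary 4 ε P.G
  b_mem : ∀ i, MemParabolicHolder P.T P.G 2 ε (fun t x => P.b t x i)
  σ_mem : ∀ i j, MemParabolicHolder P.T P.G 2 ε (fun t x => P.σ t x i j)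
  c_mem : MemParabolicHolder P.T P.G 2 ε P.c
  g_mem : MemParabolicHolder P.T P.G 2 ε P.g
  μ_mem : MemHolderBoundary P.G 2 ε P.μ
  μ_pos : ∀ z ∈ frontier P.G, 0 < P.μ z
  γ_mem : MemParabolicHolderBoundary P.T P.G 2 ε P.γ
  ψ_mem : MemParabolicHolderBoundary P.T P.G 2 ε P.ψ
  φ_mem : MemHolder P.G 4 ε P.φ
  φ_lipschitz : LocallyLipschitz P.φ

/-- The operator `𝒜 u = ½ ∑ a^{ij} ∂²u/∂x^i∂x^j + ∑ b^i ∂u/∂x^i`, with `a = σ σᵀ`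
(derivatives one-sided at `∂G`). -/
def Problem.generator (P : Problem d) (u : ℝ → Space d → ℝ) (t : ℝ) (x : Space d) : ℝ :=
  (1 / 2) * ∑ i, ∑ j, (P.σ t x * (P.σ t x).transpose) i j *
      iteratedFDerivWithin ℝ 2 (u t) (closure P.G) x
        ![EuclideanSpace.single i 1, EuclideanSpace.single j 1]
    + ∑ i, P.b t x i * fderivWithin ℝ (u t) (closure P.G) x (EuclideanSpace.single i 1)

/-- `u` is a classical solution of the parabolic problem with sticky boundary condition, in the
class `C^{(4+ε)/2, 4+ε}` on `[0,T] × closure G`; `ν` is the field of inward unit normals. -/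
structure Problem.IsSolution (P : Problem d) (ε : ℝ≥0) (ν : Space d → Space d)
    (u : ℝ → Space d → ℝ) : Prop where
  regular : MemParabolicHolder P.T P.G 4 ε u
  pde : ∀ t ∈ Icc 0 P.T, ∀ x ∈ closure P.G,
    derivWithin (fun s => u s x) (Icc 0 P.T) t + P.generator u t x
      + P.c t x * u t x + P.g t x = 0
  terminal : ∀ x ∈ closure P.G, u P.T x = P.φ x
  boundary : ∀ t ∈ Icc 0 P.T, ∀ z ∈ frontier P.G,
    -(P.μ z * P.generator u t z) + fderivWithin ℝ (u t) (closure P.G) z (ν z)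
      + P.γ t z * u t z = P.ψ t z

/-! ### The projected Euler scheme -/

/-- `π` assigns to each point outside `closure G` a nearest point of `∂G` (it is unique near
`∂G`). -/
def IsBoundaryProjection (G : Set (Space d)) (π : Space d → Space d) : Prop :=
  ∀ x ∉ closure G, π x ∈ frontier G ∧ dist x (π x) = Metric.infDist x (frontier G)

/-- A state `(t_k, X_k, Y_k, Z_k)` of the chain. -/
structure ChainState (d : ℕ) where
  /-- time -/
  t : ℝ
  /-- position -/
  X : Space d
  /-- multiplicative weight -/
  Y : ℝ
  /-- additive functional -/
  Z : ℝ

/-- The Euler step, used when the position is in `closure G`. -/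
def Problem.eulerStep (P : Problem d) (h : ℝ) (ξ : Fin d → ℝ) (s : ChainState d) :
    ChainState d where
  t := s.t + h
  X := s.X + h • P.b s.t s.X + √h • WithLp.toLp 2 ((P.σ s.t s.X).mulVec ξ)
  Y := s.Y + h * P.c s.t s.X * s.Y
  Z := s.Z + h * P.g s.t s.X * s.Y

/-- The projection step, used when the position is outside `closure G`; here
`r = dist (X, ∂G)` and the new position is the projection of `X` on `∂G`. -/
def Problem.projectionStep (P : Problem d) (π : Space d → Space d) (s : ChainState d) :
    ChainState d :=
  let r := Metric.infDist s.X (frontier P.G)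
  let X' := π s.X
  { t := s.t + r * P.μ X'
    X := X'
    Y := s.Y + r * P.γ s.t X' * s.Y + r * P.μ X' * P.c s.t X' * s.Y
    Z := s.Z - r * P.ψ s.t X' * s.Y + r * P.μ X' * P.g s.t X' * s.Y }

open Classical in
/-- The chain of the projected Euler scheme with step `h`, started at `(t₀, x, 1, 0)` and driven by
`ξ 1, ξ 2, …`. Only its states up to `steps` are used. -/
def Problem.chain (P : Problem d) (π : Space d → Space d) (h t₀ : ℝ) (x : Space d)
    (ξ : ℕ → Fin d → ℝ) : ℕ → ChainState d
  | 0 => ⟨t₀, x, 1, 0⟩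
  | k + 1 =>
    let s := P.chain π h t₀ x ξ k
    if s.X ∈ closure P.G then P.eulerStep h (ξ (k + 1)) s else P.projectionStep π s

/-- The number of steps `χ`: the scheme runs while `t_k ≤ T`. -/
def Problem.steps (P : Problem d) (π : Space d → Space d) (h t₀ : ℝ) (x : Space d)
    (ξ : ℕ → Fin d → ℝ) : ℕ :=
  sInf {k : ℕ | P.T < (P.chain π h t₀ x ξ k).t}

/-- The output `φ(X_χ) Y_χ + Z_χ` of the scheme. -/
def Problem.output (P : Problem d) (π : Space d → Space d) (h t₀ : ℝ) (x : Space d)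
    (ξ : ℕ → Fin d → ℝ) : ℝ :=
  let s := P.chain π h t₀ x ξ (P.steps π h t₀ x ξ)
  P.φ s.X * s.Y + s.Z

/-- The components `ξ_k^i` are independent and take the values `±1` with probability `1/2`. -/
structure IsRademacherSequence {Ω : Type*} [MeasurableSpace Ω] (Pr : Measure Ω)
    (ξ : ℕ → Fin d → Ω → ℝ) : Prop where
  measurable : ∀ k i, Measurable (ξ k i)
  indep : iIndepFun (fun (q : ℕ × Fin d) => ξ q.1 q.2) Pr
  prob_one : ∀ k i, Pr {ω | ξ k i ω = 1} = 1 / 2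
  prob_neg_one : ∀ k i, Pr {ω | ξ k i ω = -1} = 1 / 2

end StickyEuler

end

noncomputable section

set_option maxSynthPendingDepth 3

namespace StickyEuler

variable {d : ℕ}

/-! ### Geometry of the domain -/

/-- A local defining function is almost linear near a boundary point. -/
theorem IsLocalDefiningFunction.exists_ball {G U : Set (Space d)} {ρ : Space d → ℝ}
    (hρ : IsLocalDefiningFunction G U ρ) {z : Space d} (hz : z ∈ U) {c : ℝ} (hc : 0 < c) :
    ∃ r > 0, Metric.ball z r ⊆ U ∧ ∀ a ∈ Metric.ball z r, ∀ b ∈ Metric.ball z r,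
      |ρ a - ρ b - inner ℝ (gradient ρ z) (a - b)| ≤ c * ‖a - b‖ := by
  have hd : HasStrictFDerivAt ρ (fderiv ℝ ρ z) z :=
    (hρ.contDiffOn.contDiffAt (hρ.isOpen.mem_nhds hz)).hasStrictFDerivAt one_ne_zero
  have hin : ∀ v, inner ℝ (gradient ρ z) v = fderiv ℝ ρ z v := fun v => by
    simp [gradient]
  obtain ⟨r₁, hr₁, h₁⟩ := Metric.isOpen_iff.1 hρ.isOpen z hz
  obtain ⟨r₂, hr₂, h₂⟩ := Metric.eventually_nhds_iff_ball.1 (hd.isLittleO.bound hc)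
  refine ⟨min r₁ r₂, lt_min hr₁ hr₂, (Metric.ball_subset_ball (min_le_left _ _)).trans h₁, ?_⟩
  intro a ha b hb
  rw [hin]
  have := h₂ (a, b) (by
    rw [← ball_prod_same]
    exact ⟨Metric.ball_subset_ball (min_le_right _ _) ha,
      Metric.ball_subset_ball (min_le_right _ _) hb⟩)
  simpa using this

theorem IsLocalDefiningFunction.nonneg_of_mem_closure {G U : Set (Space d)} {ρ : Space d → ℝ}
    (hρ : IsLocalDefiningFunction G U ρ) {y : Space d} (hy : y ∈ U) (hyG : y ∈ closure G) :
    0 ≤ ρ y := by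
  by_contra! hlt
  have hcont : ContinuousAt ρ y := hρ.contDiffOn.continuousOn.continuousAt (hρ.isOpen.mem_nhds hy)
  have hev : ∀ᶠ w in nhds y, ρ w < 0 ∧ w ∈ U :=
    (hcont.eventually (gt_mem_nhds hlt)).and (hρ.isOpen.mem_nhds hy)
  obtain ⟨w, ⟨hw, hwU⟩, hwG⟩ := mem_closure_iff_nhds.1 hyG _ hev
  exact absurd ((hρ.mem_iff w hwU).1 hwG) hw.le.not_gt

/-- Near a boundary point of a `C^1` domain, moving from a point of the closure along a direction
in a cone around the normal leads into the domain. -/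
theorem exists_ball_cone {G U : Set (Space d)} {ρ : Space d → ℝ}
    (hρ : IsLocalDefiningFunction G U ρ) {z : Space d} (hz : z ∈ U) {c : ℝ} (hc : 0 < c) :
    ∃ r > 0, ∀ a ∈ Metric.ball z r, ∀ b ∈ Metric.ball z r ∩ closure G,
      c * ‖a - b‖ < inner ℝ (gradient ρ z) (a - b) → a ∈ G := by
  obtain ⟨r, hr, hU, h⟩ := hρ.exists_ball hz hc
  refine ⟨r, hr, fun a ha b hb hab => ?_⟩
  rw [hρ.mem_iff a (hU ha)]
  have h1 := hρ.nonneg_of_mem_closure (hU hb.1) hb.2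
  have h2 := (abs_le.1 (h a ha b hb.1)).1
  linarith

theorem uniqueDiffOn_closure {G : Set (Space d)} (hG : IsOpen G)
    (hb : ∀ z ∈ frontier G, ∃ U ρ, z ∈ U ∧ IsLocalDefiningFunction G U ρ) :
    UniqueDiffOn ℝ (closure G) := by
  intro z hz
  by_cases hzG : z ∈ G
  · exact ((hG.uniqueDiffWithinAt hzG)).mono subset_closure
  obtain ⟨U, ρ, hzU, hρ⟩ := hb z ⟨hz, by rwa [hG.interior_eq]⟩
  set n := gradient ρ z with hn
  have hn0 : 0 < ‖n‖ := norm_pos_iff.2 (hρ.gradient_ne_zero z hzU)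
  obtain ⟨r, hr, hcone⟩ := exists_ball_cone hρ hzU (c := ‖n‖ / 4) (by positivity)
  set K : Set (Space d) := Metric.ball z r ∩ {a | ‖n‖ / 4 * ‖a - z‖ < inner ℝ n (a - z)} with hK
  have hKG : K ⊆ closure G := fun a ha => subset_closure
    (hcone a ha.1 z ⟨Metric.mem_ball_self hr, hz⟩ ha.2)
  have hKconv : Convex ℝ K := by
    refine (convex_ball z r).inter ?_
    intro a ha b hb s t hs ht hst
    simp only [mem_ofPred_eq] at ha hb ⊢
    have he : s • a + t • b - z = s • (a - z) + t • (b - z) := by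
      have : z = (s + t) • z := by rw [hst, one_smul]
      nth_rewrite 1 [this]
      module
    rw [he, inner_add_right, inner_smul_right, inner_smul_right]
    have h1 : ‖s • (a - z) + t • (b - z)‖ ≤ s * ‖a - z‖ + t * ‖b - z‖ := by
      refine (norm_add_le _ _).trans_eq ?_
      rw [norm_smul, norm_smul, Real.norm_of_nonneg hs, Real.norm_of_nonneg ht]
    have h2 := mul_le_mul_of_nonneg_left h1 (by positivity : 0 ≤ ‖n‖ / 4)
    rcases hs.eq_or_lt with rfl | hs
    · have : t = 1 := by linarith
      subst this
      nlinarith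
    · have h3 := mul_lt_mul_of_pos_left ha hs
      have h4 := mul_le_mul_of_nonneg_left hb.le ht
      nlinarith
  have hKopen : IsOpen K := by
    refine Metric.isOpen_ball.inter (isOpen_lt ?_ ?_) <;> fun_prop
  have hmem : ∀ s : ℝ, 0 < s → s * ‖n‖ < r → z + s • n ∈ K := by
    intro s hs hsr
    refine ⟨?_, ?_⟩
    · simpa [Metric.mem_ball, dist_eq_norm, norm_smul, abs_of_pos hs] using hsr
    · simp only [mem_ofPred_eq, add_sub_cancel_left, inner_smul_right, norm_smul,
        Real.norm_of_nonneg hs.le, real_inner_self_eq_norm_sq]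
      have : 0 < s * ‖n‖ ^ 2 := by positivity
      nlinarith
  refine (uniqueDiffWithinAt_convex hKconv ?_ ?_).mono hKG
  · rw [hKopen.interior_eq]
    exact ⟨_, hmem (r / (2 * ‖n‖)) (by positivity) (by field_simp; linarith)⟩
  · have ht : Filter.Tendsto (fun s : ℝ => z + s • n) (nhdsWithin 0 (Ioi 0)) (nhds z) := by
      have : Continuous (fun s : ℝ => z + s • n) := by fun_prop
      simpa using (this.tendsto 0).mono_left nhdsWithin_le_nhds
    have ht2 : ∀ᶠ s : ℝ in nhdsWithin 0 (Ioi 0), s * ‖n‖ < r := by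
      have : Continuous (fun s : ℝ => s * ‖n‖) := by fun_prop
      exact ((this.tendsto 0).mono_left nhdsWithin_le_nhds).eventually
        (gt_mem_nhds (by simpa using hr))
    refine mem_closure_of_tendsto ht ?_
    filter_upwards [ht2, self_mem_nhdsWithin] with s hs hs0 using hmem s hs0 hs

/-- `x` and `z` are joined within `S` by three segments of length comparable to `‖z - x‖`. -/
def ShortlyJoined (S : Set (Space d)) (x z : Space d) : Prop :=
  ∃ p q, segment ℝ x p ⊆ S ∧ segment ℝ p q ⊆ S ∧ segment ℝ q z ⊆ S ∧
    ‖p - x‖ ≤ 2 * ‖z - x‖ ∧ ‖q - p‖ ≤ ‖z - x‖ ∧ ‖z - q‖ ≤ 2 * ‖z - x‖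

theorem exists_ball_shortlyJoined {G U : Set (Space d)} {ρ : Space d → ℝ}
    (hρ : IsLocalDefiningFunction G U ρ) {z₀ : Space d} (hz : z₀ ∈ U) :
    ∃ r > 0, ∀ x ∈ Metric.ball z₀ r ∩ closure G, ∀ z ∈ Metric.ball z₀ r ∩ closure G,
      ShortlyJoined (closure G) x z := by
  set n := gradient ρ z₀ with hn
  have hn0 : 0 < ‖n‖ := norm_pos_iff.2 (hρ.gradient_ne_zero z₀ hz)
  obtain ⟨r, hr, hcone⟩ := exists_ball_cone hρ hz (c := ‖n‖ / 4) (by positivity)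
  refine ⟨r / 8, by positivity, fun x hx z hz' => ?_⟩
  set D := ‖z - x‖ with hD
  set e := ‖n‖⁻¹ • n with he
  have hen : ‖e‖ = 1 := by simp [he, norm_smul, hn0.ne']
  have hine : inner ℝ n e = ‖n‖ := by
    rw [he, inner_smul_right, real_inner_self_eq_norm_sq]; field_simp
  have hD0 : 0 ≤ D := norm_nonneg _
  have hxr : ‖x - z₀‖ < r / 8 := by simpa [dist_eq_norm] using hx.1
  have hzr : ‖z - z₀‖ < r / 8 := by simpa [dist_eq_norm] using hz'.1
  have hDr : D < r / 4 := by
    have : z - x = (z - z₀) - (x - z₀) := by abel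
    rw [hD, this]
    linarith [norm_sub_le (z - z₀) (x - z₀)]
  have key : ∀ w ∈ Metric.ball z₀ (r / 8) ∩ closure G, ∀ v : Space d, ‖v‖ ≤ D → ∀ s : ℝ, 0 ≤ s →
      s ≤ 2 * D → (2 * ‖v‖ ≤ s) → w + v + s • e ∈ closure G := by
    intro w hw v hv s hs hs2 hvs
    have hwr : ‖w - z₀‖ < r / 8 := by simpa [dist_eq_norm] using hw.1
    rcases hs.eq_or_lt with rfl | hs
    · have : v = 0 := norm_le_zero_iff.1 (by linarith)
      simpa [this] using hw.2
    refine subset_closure (hcone _ ?_ w ⟨?_, hw.2⟩ ?_)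
    · rw [Metric.mem_ball, dist_eq_norm]
      have : w + v + s • e - z₀ = (w - z₀) + v + s • e := by abel
      rw [this]
      have h1 := norm_add₃_le (a := w - z₀) (b := v) (c := s • e)
      rw [norm_smul, hen, Real.norm_of_nonneg hs.le] at h1
      linarith
    · exact Metric.ball_subset_ball (by linarith) hw.1
    · have : w + v + s • e - w = v + s • e := by abel
      rw [this, inner_add_right, inner_smul_right, hine]
      have h1 := norm_add_le v (s • e)
      rw [norm_smul, hen, Real.norm_of_nonneg hs.le] at h1
      have h2 := (abs_le.1 (abs_real_inner_le_norm n v)).1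
      have h3 := mul_le_mul_of_nonneg_left h1 (by positivity : 0 ≤ ‖n‖ / 4)
      have h4 := mul_le_mul_of_nonneg_left hvs hn0.le
      have h5 := mul_pos hn0 hs
      nlinarith
  refine ⟨x + (2 * D) • e, z + (2 * D) • e, ?_, ?_, ?_, ?_, ?_, ?_⟩
  · rw [segment_eq_image']
    rintro _ ⟨θ, hθ, rfl⟩
    have := key x hx 0 (by simpa using hD0) (θ * (2 * D)) (by have := hθ.1; positivity)
      (by nlinarith [hθ.2]) (by have := hθ.1; simp; positivity)
    simpa [smul_smul] using this
  · rw [segment_eq_image']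
    rintro _ ⟨θ, hθ, rfl⟩
    have h1 : ‖θ • (z - x)‖ ≤ D := by
      rw [norm_smul, Real.norm_of_nonneg hθ.1, ← hD]; nlinarith [hθ.2]
    have := key x hx (θ • (z - x)) h1 (2 * D) (by positivity) le_rfl (by linarith)
    convert this using 1
    simp only [smul_sub, smul_add]
    abel
  · rw [segment_symm, segment_eq_image']
    rintro _ ⟨θ, hθ, rfl⟩
    have := key z hz' 0 (by simpa using hD0) (θ * (2 * D)) (by have := hθ.1; positivity)
      (by nlinarith [hθ.2]) (by have := hθ.1; simp; positivity)
    simpa [smul_smul] using this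
  · simp [norm_smul, hen, abs_of_nonneg hD0, hD.le]
  · simp [hD]
  · simp [norm_smul, hen, abs_of_nonneg hD0, hD.le]

/-- A bounded `C^1` domain is locally quasiconvex, uniformly. -/
theorem exists_shortlyJoined {G : Set (Space d)} (hG : IsOpen G) (hGb : Bornology.IsBounded G)
    (hb : ∀ z ∈ frontier G, ∃ U ρ, z ∈ U ∧ IsLocalDefiningFunction G U ρ) :
    ∃ δ > 0, ∀ x ∈ closure G, ∀ z ∈ closure G, ‖z - x‖ < δ → ShortlyJoined (closure G) x z := by
  have hloc : ∀ y : closure G, ∃ r > 0, ∀ x ∈ Metric.ball (y : Space d) r ∩ closure G,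
      ∀ z ∈ Metric.ball (y : Space d) r ∩ closure G, ShortlyJoined (closure G) x z := by
    rintro ⟨y, hy⟩
    by_cases hyG : y ∈ G
    · obtain ⟨r, hr, hrG⟩ := Metric.isOpen_iff.1 hG y hyG
      refine ⟨r, hr, fun x hx z hz => ⟨x, z, ?_, ?_, ?_, ?_, le_rfl, ?_⟩⟩
      · simpa using hx.2
      · exact ((convex_ball y r).segment_subset hx.1 hz.1).trans (hrG.trans subset_closure)
      · simpa using hz.2
      · simp
      · simp
    · obtain ⟨U, ρ, hzU, hρ⟩ := hb y ⟨hy, by rwa [hG.interior_eq]⟩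
      exact exists_ball_shortlyJoined hρ hzU
  choose r hr hj using hloc
  obtain ⟨δ, hδ, hcov⟩ := lebesgue_number_lemma_of_metric (s := closure G)
    (c := fun y : closure G => Metric.ball (y : Space d) (r y)) hGb.isCompact_closure
    (fun _ => Metric.isOpen_ball)
    (fun y hy => mem_iUnion.2 ⟨⟨y, hy⟩, Metric.mem_ball_self (hr _)⟩)
  refine ⟨δ, hδ, fun x hx z hz hxz => ?_⟩
  obtain ⟨y, hy⟩ := hcov x hx
  exact hj y x ⟨hy (Metric.mem_ball_self hδ), hx⟩ z
    ⟨hy (by simpa [Metric.mem_ball, dist_eq_norm] using hxz), hz⟩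

theorem infDist_frontier_le {G : Set (Space d)} {x y : Space d} (hx : x ∈ closure G)
    (hy : y ∉ closure G) : Metric.infDist y (frontier G) ≤ ‖y - x‖ := by
  obtain ⟨w, hw, hwf⟩ : ∃ w ∈ segment ℝ x y, w ∈ frontier G := by
    by_contra! hne
    have hsub : segment ℝ x y ⊆ interior G ∪ (closure G)ᶜ := by
      intro w hw
      by_cases hwc : w ∈ closure G
      · exact Or.inl (by_contra fun hwi => hne w hw ⟨hwc, hwi⟩)
      · exact Or.inr hwc
    obtain ⟨w, -, hw1, hw2⟩ := (convex_segment (𝕜 := ℝ) x y).isPreconnected _ _ isOpen_interior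
      isClosed_closure.isOpen_compl hsub
      ⟨x, left_mem_segment ℝ x y, (hsub (left_mem_segment ℝ x y)).resolve_right (not_not.2 hx)⟩
      ⟨y, right_mem_segment ℝ x y, hy⟩
    exact hw2 (subset_closure (interior_subset hw1))
  refine (Metric.infDist_le_dist_of_mem hwf).trans ?_
  rw [segment_eq_image'] at hw
  obtain ⟨θ, hθ, rfl⟩ := hw
  have : y - (x + θ • (y - x)) = (1 - θ) • (y - x) := by module
  rw [dist_eq_norm, this, norm_smul, Real.norm_of_nonneg (by linarith [hθ.2])]
  nlinarith [hθ.1, norm_nonneg (y - x)]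

/-- The projection moves points along the inward unit normal. -/
theorem sub_projection_eq {G : Set (Space d)} {y z v : Space d} (hy : y ∉ closure G)
    (hz : z ∈ frontier G) (hd : dist y z = Metric.infDist y (frontier G))
    (hv : IsInwardUnitNormal G z v) : y - z = -(Metric.infDist y (frontier G)) • v := by
  obtain ⟨U, ρ, hzU, hρ, rfl⟩ := hv
  set n := gradient ρ z with hn
  have hn0 : 0 < ‖n‖ := norm_pos_iff.2 (hρ.gradient_ne_zero z hzU)
  set e := ‖n‖⁻¹ • n with he
  have hne : n = ‖n‖ • e := by rw [he, smul_smul, mul_inv_cancel₀ hn0.ne', one_smul]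
  have hen : ‖e‖ = 1 := by simp [he, norm_smul, hn0.ne']
  clear_value e
  set w := y - z with hw
  rw [← hd, dist_eq_norm, ← hw]
  clear_value w
  have hpos : ∀ v, 0 < inner ℝ e v → inner ℝ w v ≤ 0 := by
    intro v hv
    have hv' : 0 < inner ℝ n v := by rw [hne, inner_smul_left]; positivity
    have hv0 : v ≠ 0 := by rintro rfl; simp at hv
    have hvn : 0 < ‖v‖ := norm_pos_iff.2 hv0
    obtain ⟨r, hr, hcone⟩ := exists_ball_cone hρ hzU (c := inner ℝ n v / (2 * ‖v‖)) (by positivity)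
    have hs : ∀ s : ℝ, 0 < s → s * ‖v‖ < r → 2 * inner ℝ w v ≤ s * ‖v‖ ^ 2 := by
      intro s hs hsr
      have hmem : z + s • v ∈ G := by
        refine hcone _ ?_ z ⟨Metric.mem_ball_self hr, hz.1⟩ ?_
        · simpa [Metric.mem_ball, dist_eq_norm, norm_smul, abs_of_pos hs] using hsr
        · rw [add_sub_cancel_left, norm_smul, inner_smul_right, Real.norm_of_nonneg hs.le,
            ← hn]
          have : 0 < s * inner ℝ n v := by positivity
          field_simp
          linarith
      have h1 := infDist_frontier_le (subset_closure hmem) hy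
      rw [← hd, dist_eq_norm, ← hw] at h1
      have h2 : y - (z + s • v) = w - s • v := by rw [hw]; abel
      rw [h2] at h1
      have h3 : ‖w‖ ^ 2 ≤ ‖w - s • v‖ ^ 2 := by gcongr
      rw [norm_sub_sq_real, inner_smul_right, norm_smul, Real.norm_of_nonneg hs.le] at h3
      have h4 : s * (2 * inner ℝ w v) ≤ s * (s * ‖v‖ ^ 2) := by nlinarith
      exact le_of_mul_le_mul_left h4 hs
    by_contra! hlt
    set s := min (r / (2 * ‖v‖)) (inner ℝ w v / ‖v‖ ^ 2) with hsdef
    have hs0 : 0 < s := lt_min (by positivity) (by positivity)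
    have h1 : s * ‖v‖ < r := by
      have : s * ‖v‖ ≤ r / (2 * ‖v‖) * ‖v‖ := by gcongr; exact min_le_left _ _
      have h2 : r / (2 * ‖v‖) * ‖v‖ = r / 2 := by field_simp
      linarith
    have h2 : s * ‖v‖ ^ 2 ≤ inner ℝ w v := by
      have : s * ‖v‖ ^ 2 ≤ inner ℝ w v / ‖v‖ ^ 2 * ‖v‖ ^ 2 := by gcongr; exact min_le_right _ _
      have h2 : inner ℝ w v / ‖v‖ ^ 2 * ‖v‖ ^ 2 = inner ℝ w v := by field_simp
      linarith
    linarith [hs s hs0 h1]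
  have hee : inner ℝ e e = (1 : ℝ) := by rw [real_inner_self_eq_norm_sq, hen, one_pow]
  set q := inner ℝ w e with hq
  have hq' : inner ℝ e w = q := real_inner_comm _ _
  have hq0 : q ≤ 0 := hpos e (by rw [hee]; exact one_pos)
  have hsq : ‖w‖ ^ 2 - q ^ 2 ≤ 0 := by
    have : ∀ η : ℝ, 0 < η → ‖w‖ ^ 2 - q ^ 2 + η * q ≤ 0 := by
      intro η hη
      have := hpos (w - q • e + η • e) (by
        rw [inner_add_right, inner_sub_right, inner_smul_right, inner_smul_right, hee, hq']
        linarith)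
      rw [inner_add_right, inner_sub_right, inner_smul_right, inner_smul_right,
        real_inner_self_eq_norm_sq, ← hq] at this
      linarith
    by_contra! hlt
    have hq1 : 0 < 1 - q := by linarith
    have h := this ((‖w‖ ^ 2 - q ^ 2) / (2 * (1 - q))) (by positivity)
    have h2 : (‖w‖ ^ 2 - q ^ 2) / (2 * (1 - q)) * (1 - q) = (‖w‖ ^ 2 - q ^ 2) / 2 := by
      field_simp
    have h3 : 0 < (‖w‖ ^ 2 - q ^ 2) / (2 * (1 - q)) := by positivity
    nlinarith
  have hqw : ‖w‖ ≤ -q := abs_le_of_sq_le_sq' (by nlinarith) (by linarith) |>.2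
  have hwq : -q ≤ ‖w‖ := by
    have := (abs_le.1 (abs_real_inner_le_norm w e)).1
    rw [hen] at this
    linarith
  have hfin : ‖w + ‖w‖ • e‖ ^ 2 = 0 := by
    rw [norm_add_sq_real, inner_smul_right, norm_smul, hen, norm_norm, ← hq]
    have : q = -‖w‖ := by linarith
    rw [this]; ring
  have : w + ‖w‖ • e = 0 := by simpa using hfin
  rw [neg_smul]
  exact eq_neg_of_add_eq_zero_left this

/-! ### Second order Taylor polynomials on a quasiconvex set -/

/-- The second derivative within `S`, as a bilinear map. -/
abbrev sndDeriv (S : Set (Space d)) (f : Space d → ℝ) (x : Space d) :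
    Space d →L[ℝ] Space d →L[ℝ] ℝ :=
  fderivWithin ℝ (fderivWithin ℝ f S) S x

/-- The second order Taylor polynomial at `x` of a function on `S`, evaluated at `y`. -/
def taylorTwo (S : Set (Space d)) (f : Space d → ℝ) (x y : Space d) : ℝ :=
  f x + fderivWithin ℝ f S x (y - x) + (1 / 2) * sndDeriv S f x (y - x) (y - x)

@[simp]
theorem taylorTwo_self (S : Set (Space d)) (f : Space d → ℝ) (x : Space d) :
    taylorTwo S f x x = f x := by
  simp [taylorTwo]

/-- Moving the base point changes the Taylor polynomial by a third order quantity. -/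
theorem hasFDerivWithinAt_taylorTwo {S : Set (Space d)} (hS : UniqueDiffOn ℝ S)
    (hSi : S ⊆ closure (interior S)) {f : Space d → ℝ} (hf : ContDiffOn ℝ 3 f S) (y : Space d)
    {x : Space d} (hx : x ∈ S) :
    HasFDerivWithinAt (fun x => taylorTwo S f x y)
      ((1 / 2 : ℝ) • ((ContinuousLinearMap.apply ℝ ℝ (y - x)).comp
        ((ContinuousLinearMap.apply ℝ (Space d →L[ℝ] ℝ) (y - x)).comp
          (fderivWithin ℝ (sndDeriv S f) S x)))) S x := by
  have hf1 : ContDiffOn ℝ 2 (fderivWithin ℝ f S) S := hf.fderivWithin hS (by norm_num)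
  have hf2 : ContDiffOn ℝ 1 (sndDeriv S f) S := hf1.fderivWithin hS (by norm_num)
  have h0 : HasFDerivWithinAt f (fderivWithin ℝ f S x) S x :=
    (hf.differentiableOn (by norm_num) x hx).hasFDerivWithinAt
  have h1 : HasFDerivWithinAt (fderivWithin ℝ f S) (sndDeriv S f x) S x :=
    (hf1.differentiableOn (by norm_num) x hx).hasFDerivWithinAt
  have h2 : HasFDerivWithinAt (sndDeriv S f) (fderivWithin ℝ (sndDeriv S f) S x) S x :=
    (hf2.differentiableOn (by norm_num) x hx).hasFDerivWithinAt
  have hw : HasFDerivWithinAt (fun x : Space d => y - x) (-ContinuousLinearMap.id ℝ (Space d)) S x :=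
    (hasFDerivWithinAt_id x S).const_sub y
  have hsymm : IsSymmSndFDerivWithinAt ℝ f S x :=
    (hf x hx).isSymmSndFDerivWithinAt (by simp; norm_num) hS (hSi hx) hx
  refine ((h0.add (h1.clm_apply hw)).add
    (((h2.clm_apply hw).clm_apply hw).const_mul (1 / 2))).congr_fderiv ?_
  ext v
  have := hsymm v (y - x)
  simp [sndDeriv] at this ⊢
  linarith

theorem abs_taylorTwo_sub_le_of_segment {S : Set (Space d)} (hS : UniqueDiffOn ℝ S)
    (hSi : S ⊆ closure (interior S)) {f : Space d → ℝ} (hf : ContDiffOn ℝ 3 f S) {M R : ℝ}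
    (hM : ∀ x ∈ S, ‖fderivWithin ℝ (sndDeriv S f) S x‖ ≤ M) {x p y : Space d}
    (hxp : segment ℝ x p ⊆ S) (hx : ‖y - x‖ ≤ R) (hp : ‖y - p‖ ≤ R) :
    |taylorTwo S f p y - taylorTwo S f x y| ≤ M * R ^ 2 * ‖p - x‖ := by
  have hM0 : 0 ≤ M := (norm_nonneg _).trans (hM x (hxp (left_mem_segment ℝ x p)))
  have hR : ∀ w ∈ segment ℝ x p, ‖y - w‖ ≤ R := by
    have hc : segment ℝ x p ⊆ Metric.closedBall y R :=
      (convex_closedBall y R).segment_subset (by simpa [dist_eq_norm, norm_sub_rev] using hx)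
        (by simpa [dist_eq_norm, norm_sub_rev] using hp)
    intro w hw
    simpa [dist_eq_norm, norm_sub_rev] using hc hw
  have key := (convex_segment (𝕜 := ℝ) x p).norm_image_sub_le_of_norm_hasFDerivWithin_le
    (f := fun x => taylorTwo S f x y) (C := M * R ^ 2)
    (fun w hw => (hasFDerivWithinAt_taylorTwo hS hSi hf y (hxp hw)).mono hxp)
    (fun w hw => ?_) (left_mem_segment ℝ x p) (right_mem_segment ℝ x p)
  · simpa using key
  · refine ContinuousLinearMap.opNorm_le_bound _ (by positivity) fun v => ?_
    simp only [smul_apply, ContinuousLinearMap.comp_apply,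
      ContinuousLinearMap.apply_apply, norm_smul]
    have hR0 : 0 ≤ R := (norm_nonneg _).trans hx
    have h1 := (fderivWithin ℝ (sndDeriv S f) S w).le_of_opNorm_le (hM w (hxp hw)) v
    have h2 := ((fderivWithin ℝ (sndDeriv S f) S w) v).le_of_opNorm_le_of_le h1 (hR w hw)
    have h3 := ((fderivWithin ℝ (sndDeriv S f) S w) v (y - w)).le_of_opNorm_le_of_le h2 (hR w hw)
    calc ‖(1 / 2 : ℝ)‖ * ‖(fderivWithin ℝ (sndDeriv S f) S w) v (y - w) (y - w)‖
        ≤ 1 * (((M * ‖v‖) * R) * R) := by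
          refine mul_le_mul (by norm_num) h3 (norm_nonneg _) zero_le_one
      _ = M * R ^ 2 * ‖v‖ := by ring

/-- The derivatives of `f` within `S` up to order three are bounded by `M`. -/
structure DerivBound (S : Set (Space d)) (M : ℝ) (f : Space d → ℝ) : Prop where
  contDiffOn : ContDiffOn ℝ 3 f S
  zero : ∀ x ∈ S, |f x| ≤ M
  one : ∀ x ∈ S, ‖fderivWithin ℝ f S x‖ ≤ M
  two : ∀ x ∈ S, ‖sndDeriv S f x‖ ≤ M
  three : ∀ x ∈ S, ‖fderivWithin ℝ (sndDeriv S f) S x‖ ≤ M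

theorem DerivBound.abs_taylorTwo_le {S : Set (Space d)} {M : ℝ} {f : Space d → ℝ}
    (hf : DerivBound S M f) {x : Space d} (hx : x ∈ S) (y : Space d) :
    |taylorTwo S f x y| ≤ M * (1 + ‖y - x‖ + ‖y - x‖ ^ 2) := by
  have h0 := hf.zero x hx
  have hM : 0 ≤ M := (abs_nonneg _).trans h0
  have h1 : |fderivWithin ℝ f S x (y - x)| ≤ M * ‖y - x‖ :=
    (fderivWithin ℝ f S x).le_of_opNorm_le (hf.one x hx) _
  have h2 : |sndDeriv S f x (y - x) (y - x)| ≤ M * ‖y - x‖ * ‖y - x‖ :=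
    (sndDeriv S f x (y - x)).le_of_opNorm_le ((sndDeriv S f x).le_of_opNorm_le (hf.two x hx) _) _
  unfold taylorTwo
  have h3 : 0 ≤ M * ‖y - x‖ * ‖y - x‖ := by positivity
  rw [abs_le] at *
  constructor <;> nlinarith

/-- Compatibility of the Taylor polynomials based at two points of a quasiconvex set. -/
theorem exists_abs_taylorTwo_sub_le {S : Set (Space d)} (hS : UniqueDiffOn ℝ S)
    (hSi : S ⊆ closure (interior S)) {δ : ℝ} (hδ : 0 < δ)
    (hj : ∀ x ∈ S, ∀ z ∈ S, ‖z - x‖ < δ → ShortlyJoined S x z) {M : ℝ} (hM : 0 ≤ M) :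
    ∃ C, 0 ≤ C ∧ ∀ f, DerivBound S M f → ∀ x ∈ S, ∀ z ∈ S, ∀ y,
      |taylorTwo S f z y - taylorTwo S f x y| ≤ C * (‖z - x‖ + ‖y - x‖) ^ 3 := by
  refine ⟨45 * M + 2 * M * (δ⁻¹ ^ 3 + δ⁻¹ ^ 2 + δ⁻¹), by positivity, fun f hf x hx z hz y => ?_⟩
  set D := ‖z - x‖ with hD
  set A := D + ‖y - x‖ with hA
  have hD0 : 0 ≤ D := norm_nonneg _
  have hyx : ‖y - x‖ ≤ A := by linarith
  have hDA : D ≤ A := by linarith [norm_nonneg (y - x)]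
  have hA0 : 0 ≤ A := hD0.trans hDA
  have hyz : ‖y - z‖ ≤ A := by
    have : y - z = (y - x) - (z - x) := by abel
    rw [this]
    linarith [norm_sub_le (y - x) (z - x)]
  rcases lt_or_ge D δ with hlt | hge
  · obtain ⟨p, q, h1, h2, h3, hp, hq, hzq⟩ := hj x hx z hz hlt
    have hyp : ‖y - p‖ ≤ 3 * A := by
      have : y - p = (y - x) - (p - x) := by abel
      rw [this]
      linarith [norm_sub_le (y - x) (p - x)]
    have hyq : ‖y - q‖ ≤ 3 * A := by
      have : y - q = (y - z) + (z - q) := by abel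
      rw [this]
      linarith [norm_add_le (y - z) (z - q)]
    have e1 := abs_taylorTwo_sub_le_of_segment hS hSi hf.contDiffOn hf.three h1 (R := 3 * A)
      (by linarith) hyp
    have e2 := abs_taylorTwo_sub_le_of_segment hS hSi hf.contDiffOn hf.three h2 hyp hyq
    have e3 := abs_taylorTwo_sub_le_of_segment hS hSi hf.contDiffOn hf.three h3 hyq (by linarith)
    have e4 : taylorTwo S f z y - taylorTwo S f x y =
      (taylorTwo S f z y - taylorTwo S f q y) + (taylorTwo S f q y - taylorTwo S f p y) +
        (taylorTwo S f p y - taylorTwo S f x y) := by ring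
    rw [e4]
    refine (abs_add_three _ _ _).trans ?_
    have hc : 0 ≤ M * (3 * A) ^ 2 := by positivity
    have e5 : M * (3 * A) ^ 2 * (‖z - q‖ + ‖q - p‖ + ‖p - x‖) ≤ M * (3 * A) ^ 2 * (5 * A) :=
      mul_le_mul_of_nonneg_left (by linarith) hc
    have e6 : 0 ≤ 2 * M * (δ⁻¹ ^ 3 + δ⁻¹ ^ 2 + δ⁻¹) * A ^ 3 := by positivity
    nlinarith
  · have hAδ : 1 ≤ δ⁻¹ * A := by
      rw [inv_mul_eq_div, one_le_div hδ]; linarith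
    have e1 := hf.abs_taylorTwo_le hx y
    have e2 := hf.abs_taylorTwo_le hz y
    have e3 : ∀ r, 0 ≤ r → r ≤ A → M * (1 + r + r ^ 2) ≤
        M * (δ⁻¹ ^ 3 + δ⁻¹ ^ 2 + δ⁻¹) * A ^ 3 := by
      intro r hr hrA
      rw [mul_assoc]
      refine mul_le_mul_of_nonneg_left ?_ hM
      have f1 : (1 : ℝ) ≤ (δ⁻¹ * A) ^ 3 := one_le_pow₀ hAδ
      have f2 : A ≤ A * (δ⁻¹ * A) ^ 2 := le_mul_of_one_le_right hA0 (one_le_pow₀ hAδ)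
      have f3 : A ^ 2 ≤ A ^ 2 * (δ⁻¹ * A) := le_mul_of_one_le_right (by positivity) hAδ
      have f4 : r ^ 2 ≤ A ^ 2 := by gcongr
      nlinarith
    have e4 := e3 _ (norm_nonneg (y - x)) hyx
    have e5 := e3 _ (norm_nonneg (y - z)) hyz
    have e6 := abs_sub (taylorTwo S f z y) (taylorTwo S f x y)
    have e7 : 0 ≤ 45 * M * A ^ 3 := by positivity
    nlinarith

/-! ### Uniform bounds on the data -/

theorem abs_sub_le_of_abs_derivWithin_le {T M : ℝ} {f : ℝ → ℝ}
    (hf : DifferentiableOn ℝ f (Icc 0 T))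
    (hM : ∀ t ∈ Icc 0 T, |derivWithin f (Icc 0 T) t| ≤ M) {s t : ℝ} (hs : s ∈ Icc 0 T)
    (ht : t ∈ Icc 0 T) : |f t - f s| ≤ M * |t - s| :=
  Convex.norm_image_sub_le_of_norm_derivWithin_le hf hM (convex_Icc 0 T) hs ht

theorem abs_sub_sub_le_of_abs_derivWithin_le {T M : ℝ} {f : ℝ → ℝ} (hT : 0 < T)
    (hf : ContDiffOn ℝ 2 f (Icc 0 T))
    (hM : ∀ t ∈ Icc 0 T, |iteratedDerivWithin 2 f (Icc 0 T) t| ≤ M) {s t : ℝ}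
    (hs : s ∈ Icc 0 T) (ht : t ∈ Icc 0 T) :
    |f t - f s - (t - s) * derivWithin f (Icc 0 T) s| ≤ M * (t - s) ^ 2 := by
  have hu : UniqueDiffOn ℝ (Icc 0 T) := uniqueDiffOn_Icc hT
  have hf1 : DifferentiableOn ℝ (derivWithin f (Icc 0 T)) (Icc 0 T) :=
    (hf.derivWithin hu (m := 1) (by norm_num)).differentiableOn (by norm_num)
  have hlip : ∀ r ∈ Icc 0 T,
      |derivWithin f (Icc 0 T) r - derivWithin f (Icc 0 T) s| ≤ M * |r - s| := by
    intro r hr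
    refine abs_sub_le_of_abs_derivWithin_le hf1 (fun t ht => ?_) hs hr
    have := hM t ht
    rwa [iteratedDerivWithin_succ, iteratedDerivWithin_one] at this
  have hM0 : 0 ≤ M := (abs_nonneg _).trans (hM s hs)
  have hsub : uIcc s t ⊆ Icc 0 T := ordConnected_Icc.uIcc_subset hs ht
  have key := Convex.norm_image_sub_le_of_norm_hasDerivWithin_le (s := uIcc s t)
    (f := fun r => f r - (r - s) * derivWithin f (Icc 0 T) s)
    (f' := fun r => derivWithin f (Icc 0 T) r - 1 * derivWithin f (Icc 0 T) s)
    (C := M * |t - s|) (x := s) (y := t)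
    (fun r hr => (((hf.differentiableOn (by norm_num) r (hsub hr)).hasDerivWithinAt).mono hsub).sub
      (((hasDerivWithinAt_id r _).sub_const s).mul_const _))
    (fun r hr => by
      rw [one_mul]
      refine (hlip r (hsub hr)).trans (mul_le_mul_of_nonneg_left ?_ hM0)
      exact abs_sub_left_of_mem_uIcc hr)
    (convex_uIcc s t) left_mem_uIcc right_mem_uIcc
  simp only [Real.norm_eq_abs, sub_self, zero_mul, sub_zero] at key
  have e : f t - (t - s) * derivWithin f (Icc 0 T) s - f s =
    f t - f s - (t - s) * derivWithin f (Icc 0 T) s := by ring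
  rw [e, mul_assoc, abs_mul_abs_self, ← sq] at key
  exact key

theorem MemParabolicHolder.exists_bound {T : ℝ} {G : Set (Space d)} {p : ℕ} {ε : ℝ≥0}
    {f : ℝ → Space d → ℝ} (hf : MemParabolicHolder T G p ε f) (hG : Bornology.IsBounded G)
    {i j : ℕ} (hij : 2 * i + j ≤ p) :
    ∃ C, ∀ t ∈ Icc 0 T, ∀ x ∈ closure G, ‖mixedDeriv T G i j f t x‖ ≤ C := by
  obtain ⟨C, hC⟩ := (isCompact_Icc.prod hG.isCompact_closure).exists_bound_of_continuousOn
    (hf.continuousOn i j hij)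
  exact ⟨C, fun t ht x hx => hC (t, x) ⟨ht, hx⟩⟩

theorem norm_mixedDeriv_time {T : ℝ} {G : Set (Space d)} {f : ℝ → Space d → ℝ} (i : ℕ) (t : ℝ)
    (x : Space d) :
    ‖mixedDeriv T G i 0 f t x‖ = |iteratedDerivWithin i (fun s => f s x) (Icc 0 T) t| := by
  rw [mixedDeriv, norm_iteratedFDerivWithin_zero, Real.norm_eq_abs]

theorem mixedDeriv_space {T : ℝ} {G : Set (Space d)} {f : ℝ → Space d → ℝ} (j : ℕ) (t : ℝ)
    (x : Space d) :
    mixedDeriv T G 0 j f t x = iteratedFDerivWithin ℝ j (f t) (closure G) x := by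
  simp [mixedDeriv]

/-- `f` is bounded by `M` and `M`-Lipschitz in time on `[0,T] × closure G`. -/
structure CoefBound (T : ℝ) (G : Set (Space d)) (M : ℝ) (f : ℝ → Space d → ℝ) : Prop where
  bound : ∀ t ∈ Icc 0 T, ∀ x ∈ closure G, |f t x| ≤ M
  lipschitz : ∀ s ∈ Icc 0 T, ∀ t ∈ Icc 0 T, ∀ x ∈ closure G, |f t x - f s x| ≤ M * |t - s|

theorem MemParabolicHolder.eventually_coefBound {T : ℝ} {G : Set (Space d)} {p : ℕ} {ε : ℝ≥0}
    {f : ℝ → Space d → ℝ} (hf : MemParabolicHolder T G p ε f) (hG : Bornology.IsBounded G)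
    (hp : 2 ≤ p) : ∀ᶠ M in Filter.atTop, CoefBound T G M f := by
  obtain ⟨C₀, h₀⟩ := hf.exists_bound hG (i := 0) (j := 0) (by lia)
  obtain ⟨C₁, h₁⟩ := hf.exists_bound hG (i := 1) (j := 0) (by lia)
  filter_upwards [Filter.eventually_ge_atTop C₀, Filter.eventually_ge_atTop C₁] with M hM₀ hM₁
  refine ⟨fun t ht x hx => ?_, fun s hs t ht x hx => ?_⟩
  · have := h₀ t ht x hx
    rw [norm_mixedDeriv_time, iteratedDerivWithin_zero] at this
    exact this.trans hM₀
  · refine abs_sub_le_of_abs_derivWithin_le (f := fun s => f s x)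
      ((hf.contDiffOn_time x hx).differentiableOn ?_)
      (fun t ht => ?_) hs ht
    · have : p / 2 ≠ 0 := by lia
      exact_mod_cast this
    · have := h₁ t ht x hx
      rw [norm_mixedDeriv_time, iteratedDerivWithin_one] at this
      exact this.trans hM₁

theorem MemParabolicHolder.eventually_derivBound {T : ℝ} {G : Set (Space d)} {p : ℕ} {ε : ℝ≥0}
    {f : ℝ → Space d → ℝ} (hf : MemParabolicHolder T G p ε f) (hG : Bornology.IsBounded G)
    (hS : UniqueDiffOn ℝ (closure G)) (hp : 3 ≤ p) :
    ∀ᶠ M in Filter.atTop, ∀ t ∈ Icc 0 T, DerivBound (closure G) M (f t) := by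
  obtain ⟨C₀, h₀⟩ := hf.exists_bound hG (i := 0) (j := 0) (by lia)
  obtain ⟨C₁, h₁⟩ := hf.exists_bound hG (i := 0) (j := 1) (by lia)
  obtain ⟨C₂, h₂⟩ := hf.exists_bound hG (i := 0) (j := 2) (by lia)
  obtain ⟨C₃, h₃⟩ := hf.exists_bound hG (i := 0) (j := 3) (by lia)
  simp only [mixedDeriv_space] at h₀ h₁ h₂ h₃
  filter_upwards [Filter.eventually_ge_atTop C₀, Filter.eventually_ge_atTop C₁,
    Filter.eventually_ge_atTop C₂, Filter.eventually_ge_atTop C₃] with M hM₀ hM₁ hM₂ hM₃ t ht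
  refine ⟨?_, fun x hx => ?_, fun x hx => ?_, fun x hx => ?_, fun x hx => ?_⟩
  · have := hf.contDiffOn_space 0 (by lia) t ht
    simp only [iteratedDerivWithin_zero, mul_zero, tsub_zero] at this
    exact this.of_le (by exact_mod_cast hp)
  · have := h₀ t ht x hx
    rw [norm_iteratedFDerivWithin_zero] at this
    exact this.trans hM₀
  · have := h₁ t ht x hx
    rw [norm_iteratedFDerivWithin_one _ (hS x hx)] at this
    exact this.trans hM₁
  · have := h₂ t ht x hx
    rw [← norm_iteratedFDerivWithin_fderivWithin hS hx,
      norm_iteratedFDerivWithin_one _ (hS x hx)] at this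
    exact this.trans hM₂
  · have := h₃ t ht x hx
    rw [← norm_iteratedFDerivWithin_fderivWithin hS hx,
      ← norm_iteratedFDerivWithin_fderivWithin hS hx,
      norm_iteratedFDerivWithin_one _ (hS x hx)] at this
    exact this.trans hM₃

theorem MemParabolicHolder.eventually_taylor_time {T : ℝ} (hT : 0 < T) {G : Set (Space d)} {p : ℕ}
    {ε : ℝ≥0} {f : ℝ → Space d → ℝ} (hf : MemParabolicHolder T G p ε f)
    (hG : Bornology.IsBounded G) (hp : 4 ≤ p) :
    ∀ᶠ M in Filter.atTop, ∀ x ∈ closure G, ∀ s ∈ Icc 0 T, ∀ t ∈ Icc 0 T,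
      |f t x - f s x - (t - s) * derivWithin (fun s => f s x) (Icc 0 T) s| ≤ M * (t - s) ^ 2 := by
  obtain ⟨C₂, h₂⟩ := hf.exists_bound hG (i := 2) (j := 0) (by lia)
  filter_upwards [Filter.eventually_ge_atTop C₂] with M hM x hx s hs t ht
  refine abs_sub_sub_le_of_abs_derivWithin_le (f := fun s => f s x) hT
    ((hf.contDiffOn_time x hx).of_le ?_) (fun t ht => ?_) hs ht
  · have : 2 ≤ p / 2 := by lia
    exact_mod_cast this
  · have := h₂ t ht x hx
    rw [norm_mixedDeriv_time] at this
    exact this.trans hM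

theorem MemParabolicHolderBoundary.eventually_abs_le {T : ℝ} {G : Set (Space d)} {p : ℕ} {ε : ℝ≥0}
    {v : ℝ → Space d → ℝ} (hv : MemParabolicHolderBoundary T G p ε v)
    (hG : Bornology.IsBounded G) :
    ∀ᶠ M in Filter.atTop, ∀ t ∈ Icc 0 T, ∀ z ∈ frontier G, |v t z| ≤ M := by
  obtain ⟨V, hV, hVv⟩ := hv
  obtain ⟨C₀, h₀⟩ := hV.exists_bound hG (i := 0) (j := 0) (by lia)
  filter_upwards [Filter.eventually_ge_atTop C₀] with M hM t ht z hz
  have := h₀ t ht z (frontier_subset_closure hz)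
  rw [norm_mixedDeriv_time, iteratedDerivWithin_zero, hVv t ht z hz] at this
  exact this.trans hM

theorem MemHolderBoundary.eventually_mem_Icc {G : Set (Space d)} {p : ℕ} {ε : ℝ≥0}
    {v : Space d → ℝ} (hv : MemHolderBoundary G p ε v) (hG : Bornology.IsBounded G)
    (hpos : ∀ z ∈ frontier G, 0 < v z) :
    ∀ᶠ M in Filter.atTop, ∀ z ∈ frontier G, v z ≤ M ∧ 1 ≤ M * v z := by
  obtain ⟨F, hF, hFv⟩ := hv
  have hcont : ContinuousOn v (frontier G) :=
    (hF.contDiffOn.continuousOn.mono frontier_subset_closure).congr hFv.symm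
  have hcomp : IsCompact (frontier G) :=
    hG.isCompact_closure.of_isClosed_subset isClosed_frontier frontier_subset_closure
  obtain ⟨C, hC⟩ := hcomp.exists_bound_of_continuousOn hcont
  obtain ⟨C', hC'⟩ := hcomp.exists_bound_of_continuousOn
    (hcont.inv₀ fun z hz => (hpos z hz).ne')
  filter_upwards [Filter.eventually_ge_atTop C, Filter.eventually_ge_atTop C'] with M h1 h2 z hz
  refine ⟨(le_abs_self _).trans ((hC z hz).trans h1), ?_⟩
  have h3 : (v z)⁻¹ ≤ M := (le_abs_self _).trans ((hC' z hz).trans h2)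
  rwa [inv_le_iff_one_le_mul₀ (hpos z hz)] at h3

/-- All the bounds on the data and on the solution that enter the error estimate. -/
structure UniformBounds (P : Problem d) (u : ℝ → Space d → ℝ) (M : ℝ) : Prop where
  one_le : 1 ≤ M
  deriv : ∀ t ∈ Icc 0 P.T, DerivBound (closure P.G) M (u t)
  u_bound : CoefBound P.T P.G M u
  taylor_time : ∀ x ∈ closure P.G, ∀ s ∈ Icc 0 P.T, ∀ t ∈ Icc 0 P.T,
    |u t x - u s x - (t - s) * derivWithin (fun s => u s x) (Icc 0 P.T) s| ≤ M * (t - s) ^ 2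
  deriv_time : ∀ t ∈ Icc 0 P.T, ∀ x ∈ closure P.G,
    |derivWithin (fun s => u s x) (Icc 0 P.T) t| ≤ M
  b_bound : ∀ i, CoefBound P.T P.G M (fun t x => P.b t x i)
  σ_bound : ∀ i j, CoefBound P.T P.G M (fun t x => P.σ t x i j)
  c_bound : CoefBound P.T P.G M P.c
  g_bound : CoefBound P.T P.G M P.g
  μ_bound : ∀ z ∈ frontier P.G, P.μ z ≤ M ∧ 1 ≤ M * P.μ z
  γ_bound : ∀ t ∈ Icc 0 P.T, ∀ z ∈ frontier P.G, |P.γ t z| ≤ M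
  ψ_bound : ∀ t ∈ Icc 0 P.T, ∀ z ∈ frontier P.G, |P.ψ t z| ≤ M

theorem exists_localDefiningFunction {k : ℕ} {ε : ℝ≥0} {G : Set (Space d)}
    (h : HasHolderBoundary k ε G) (z : Space d) (hz : z ∈ frontier G) :
    ∃ U ρ, z ∈ U ∧ IsLocalDefiningFunction G U ρ := by
  obtain ⟨U, ρ, hzU, hρ, -⟩ := h z hz
  exact ⟨U, ρ, hzU, hρ⟩

theorem Problem.IsSolution.exists_uniformBounds {P : Problem d} {ε : ℝ≥0} {ν : Space d → Space d}
    {u : ℝ → Space d → ℝ} (hP : P.IsAdmissible ε) (hu : P.IsSolution ε ν u) :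
    ∃ M, UniformBounds P u M := by
  have hG := hP.isBounded
  have hS := uniqueDiffOn_closure hP.isOpen (exists_localDefiningFunction hP.boundary)
  obtain ⟨C₁, h₁⟩ := hu.regular.exists_bound hG (i := 1) (j := 0) (by lia)
  refine Filter.Eventually.exists (f := Filter.atTop) ?_
  filter_upwards [Filter.eventually_ge_atTop 1, hu.regular.eventually_derivBound hG hS (by lia),
    hu.regular.eventually_coefBound hG (by lia),
    hu.regular.eventually_taylor_time hP.T_pos hG (by lia), Filter.eventually_ge_atTop C₁,
    Filter.eventually_all.2 fun i => (hP.b_mem i).eventually_coefBound hG le_rfl,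
    Filter.eventually_all.2 fun i => Filter.eventually_all.2 fun j =>
      (hP.σ_mem i j).eventually_coefBound hG le_rfl,
    hP.c_mem.eventually_coefBound hG le_rfl, hP.g_mem.eventually_coefBound hG le_rfl,
    hP.μ_mem.eventually_mem_Icc hG hP.μ_pos, hP.γ_mem.eventually_abs_le hG,
    hP.ψ_mem.eventually_abs_le hG] with M a1 a2 a3 a4 a5 a6 a7 a8 a9 a10 a11 a12
  refine ⟨a1, a2, a3, a4, fun t ht x hx => ?_, a6, a7, a8, a9, a10, a11, a12⟩
  have := h₁ t ht x hx
  rw [norm_mixedDeriv_time, iteratedDerivWithin_one] at this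
  exact this.trans a5

/-! ### Averages over signs -/

/-- The vector of signs coded by a Boolean vector. -/
def signs (e : Fin d → Bool) : Fin d → ℝ := fun i => if e i then 1 else -1

/-- The average over all vectors of signs. -/
def signAvg (F : (Fin d → ℝ) → ℝ) : ℝ := (∑ e : Fin d → Bool, F (signs e)) / 2 ^ d

theorem abs_signs (e : Fin d → Bool) (i : Fin d) : |signs e i| = 1 := by
  unfold signs; split <;> simp

theorem signAvg_const (a : ℝ) : signAvg (fun _ : Fin d → ℝ => a) = a := by
  simp [signAvg]

theorem signAvg_add (F F' : (Fin d → ℝ) → ℝ) :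
    signAvg (fun ξ => F ξ + F' ξ) = signAvg F + signAvg F' := by
  simp [signAvg, Finset.sum_add_distrib, add_div]

theorem signAvg_sub (F F' : (Fin d → ℝ) → ℝ) :
    signAvg (fun ξ => F ξ - F' ξ) = signAvg F - signAvg F' := by
  simp [signAvg, Finset.sum_sub_distrib, sub_div]

theorem signAvg_mul_const (F : (Fin d → ℝ) → ℝ) (a : ℝ) :
    signAvg (fun ξ => F ξ * a) = signAvg F * a := by
  simp only [signAvg, ← Finset.sum_mul]; ring

theorem signAvg_sum {ι : Type*} (s : Finset ι) (F : ι → (Fin d → ℝ) → ℝ) :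
    signAvg (fun ξ => ∑ i ∈ s, F i ξ) = ∑ i ∈ s, signAvg (F i) := by
  simp only [signAvg, ← Finset.sum_div]
  rw [Finset.sum_comm]

theorem abs_signAvg_le {F : (Fin d → ℝ) → ℝ} {B : ℝ} (h : ∀ e, |F (signs e)| ≤ B) :
    |signAvg F| ≤ B := by
  rw [signAvg, abs_div, abs_of_pos (by positivity : (0 : ℝ) < 2 ^ d), div_le_iff₀ (by positivity)]
  refine (Finset.abs_sum_le_sum_abs _ _).trans ((Finset.sum_le_sum fun e _ => h e).trans_eq ?_)
  simp [mul_comm]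

/-- Flipping one sign. -/
def flipSign (i : Fin d) : (Fin d → Bool) ≃ (Fin d → Bool) where
  toFun e := Function.update e i (!e i)
  invFun e := Function.update e i (!e i)
  left_inv e := by simp
  right_inv e := by simp

theorem signs_flipSign_self (i : Fin d) (e : Fin d → Bool) :
    signs (flipSign i e) i = -signs e i := by
  cases h : e i <;> simp [signs, flipSign, h]

theorem signs_flipSign_of_ne {i j : Fin d} (h : j ≠ i) (e : Fin d → Bool) :
    signs (flipSign i e) j = signs e j := by
  simp [signs, flipSign, h]

theorem signAvg_coord (i : Fin d) : signAvg (fun ξ => ξ i) = 0 := by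
  have h : ∑ e : Fin d → Bool, signs e i = ∑ e : Fin d → Bool, -signs e i :=
    ((flipSign i).sum_comp fun e => signs e i).symm.trans (by simp [signs_flipSign_self])
  rw [Finset.sum_neg_distrib] at h
  have : ∑ e : Fin d → Bool, signs e i = 0 := by linarith
  simp [signAvg, this]

theorem signAvg_coord_mul (i j : Fin d) :
    signAvg (fun ξ => ξ i * ξ j) = if i = j then 1 else 0 := by
  split_ifs with hij
  · subst hij
    have : ∀ e : Fin d → Bool, signs e i * signs e i = 1 := fun e => by
      rw [← abs_mul_abs_self, abs_signs, one_mul]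
    simp [signAvg, this]
  · have h : ∑ e : Fin d → Bool, signs e i * signs e j = ∑ e : Fin d → Bool, -(signs e i * signs e j) :=
      ((flipSign i).sum_comp fun e => signs e i * signs e j).symm.trans
        (by simp [signs_flipSign_self, signs_flipSign_of_ne (Ne.symm hij)])
    rw [Finset.sum_neg_distrib] at h
    have : ∑ e : Fin d → Bool, signs e i * signs e j = 0 := by linarith
    simp [signAvg, this]

theorem signAvg_quadratic (α : ℝ) (β : Fin d → ℝ) (B : Fin d → Fin d → ℝ) :
    signAvg (fun ξ => α + ∑ i, ξ i * β i + ∑ i, ∑ j, ξ i * ξ j * B i j) = α + ∑ i, B i i := by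
  rw [signAvg_add, signAvg_add, signAvg_const, signAvg_sum, signAvg_sum]
  simp [signAvg_sum, signAvg_mul_const, signAvg_coord, signAvg_coord_mul]

/-! ### The Euler increment -/

/-- The increment of the position in an Euler step. -/
def eulerIncrement (h : ℝ) (b : Space d) (σ : Matrix (Fin d) (Fin d) ℝ) (ξ : Fin d → ℝ) :
    Space d :=
  h • b + √h • WithLp.toLp 2 (σ.mulVec ξ)

theorem norm_le_sum_abs (v : Space d) : ‖v‖ ≤ ∑ i, |v i| := by
  have hv : v = ∑ i, v i • EuclideanSpace.single i (1 : ℝ) := by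
    ext j; simp [Finset.sum_apply, Pi.single_apply]
  calc ‖v‖ = ‖∑ i, v i • EuclideanSpace.single i (1 : ℝ)‖ := by rw [← hv]
    _ ≤ ∑ i, ‖v i • EuclideanSpace.single i (1 : ℝ)‖ := norm_sum_le _ _
    _ = _ := by simp [norm_smul]

theorem norm_eulerIncrement_le {h M : ℝ} (hh : h ∈ Ioo 0 1) {b : Space d}
    {σ : Matrix (Fin d) (Fin d) ℝ} (hb : ∀ i, |b i| ≤ M) (hσ : ∀ i j, |σ i j| ≤ M)
    (e : Fin d → Bool) :
    ‖eulerIncrement h b σ (signs e)‖ ≤ (d + d ^ 2) * M * √h := by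
  have h1 : ‖b‖ ≤ d * M :=
    (norm_le_sum_abs b).trans ((Finset.sum_le_sum fun i _ => hb i).trans_eq (by simp))
  have h2 : ‖(WithLp.toLp 2 (σ.mulVec (signs e)) : Space d)‖ ≤ d ^ 2 * M := by
    refine (norm_le_sum_abs _).trans ((Finset.sum_le_sum (g := fun _ => d * M) fun i _ => ?_).trans_eq
      (by simp; ring))
    refine (Finset.abs_sum_le_sum_abs (fun j => σ i j * signs e j) Finset.univ).trans
      ((Finset.sum_le_sum (g := fun _ => M) fun j _ => ?_).trans_eq (by simp))
    rw [abs_mul, abs_signs, mul_one]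
    exact hσ i j
  have hq : 0 < √h := Real.sqrt_pos.2 hh.1
  have hq1 : h ≤ √h := by
    have : √h ≤ 1 := Real.sqrt_le_one.2 hh.2.le
    nlinarith [Real.mul_self_sqrt hh.1.le]
  calc ‖eulerIncrement h b σ (signs e)‖ 
        ≤ h * ‖b‖ + √h * ‖(WithLp.toLp 2 (σ.mulVec (signs e)) : Space d)‖ := by
        refine (norm_add_le _ _).trans_eq ?_
        rw [norm_smul, norm_smul, Real.norm_of_nonneg hh.1.le, Real.norm_of_nonneg hq.le]
    _ ≤ √h * (d * M) + √h * (d ^ 2 * M) := by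
        gcongr
    _ = _ := by ring

/-- The columns of a matrix, as vectors of the Euclidean space. -/
def column (σ : Matrix (Fin d) (Fin d) ℝ) (j : Fin d) : Space d := WithLp.toLp 2 fun i => σ i j

theorem toLp_mulVec (σ : Matrix (Fin d) (Fin d) ℝ) (ξ : Fin d → ℝ) :
    (WithLp.toLp 2 (σ.mulVec ξ) : Space d) = ∑ j, ξ j • column σ j := by
  ext i
  simp [column, Matrix.mulVec, dotProduct, mul_comm]

theorem signAvg_taylorTwo {S : Set (Space d)} {f : Space d → ℝ} {x b : Space d}
    {σ : Matrix (Fin d) (Fin d) ℝ} {h : ℝ} (hh : 0 ≤ h) :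
    signAvg (fun ξ => taylorTwo S f x (x + eulerIncrement h b σ ξ)) =
      f x + h * fderivWithin ℝ f S x b + 1 / 2 * h ^ 2 * sndDeriv S f x b b +
        1 / 2 * h * ∑ j, sndDeriv S f x (column σ j) (column σ j) := by
  set A := fderivWithin ℝ f S x
  set B := sndDeriv S f x
  have hs : √h * √h = h := Real.mul_self_sqrt hh
  have key : ∀ ξ : Fin d → ℝ, taylorTwo S f x (x + eulerIncrement h b σ ξ) =
      (f x + h * A b + 1 / 2 * h ^ 2 * B b b) +
      ∑ i, ξ i * (√h * A (column σ i) +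
        1 / 2 * h * √h * (B b (column σ i) + B (column σ i) b)) +
      ∑ i, ∑ j, ξ i * ξ j * (1 / 2 * h * B (column σ i) (column σ j)) := by
    intro ξ
    have e1 : ∑ i, ξ i * (√h * A (column σ i) +
        1 / 2 * h * √h * (B b (column σ i) + B (column σ i) b)) =
        √h * ∑ i, ξ i * A (column σ i) + 1 / 2 * h * √h * ∑ i, ξ i * B b (column σ i)
          + 1 / 2 * h * √h * ∑ i, ξ i * B (column σ i) b := by
      simp only [Finset.mul_sum, ← Finset.sum_add_distrib]
      exact Finset.sum_congr rfl fun i _ => by ring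
    have e2 : ∑ i, ∑ j, ξ i * ξ j * (1 / 2 * h * B (column σ i) (column σ j)) =
        1 / 2 * h * ∑ i, ξ i * ∑ j, ξ j * B (column σ i) (column σ j) := by
      simp only [Finset.mul_sum]
      exact Finset.sum_congr rfl fun i _ => Finset.sum_congr rfl fun j _ => by ring
    have e3 : B (∑ i, ξ i • column σ i) (∑ i, ξ i • column σ i) =
        ∑ i, ξ i * ∑ j, ξ j * B (column σ i) (column σ j) := by
      simp only [map_sum, map_smul, sum_apply, smul_apply, smul_eq_mul, Finset.mul_sum]
      rw [Finset.sum_comm]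
      exact Finset.sum_congr rfl fun i _ => Finset.sum_congr rfl fun j _ => by ring
    have e4 : A (∑ i, ξ i • column σ i) = ∑ i, ξ i * A (column σ i) := by simp
    have e5 : B b (∑ i, ξ i • column σ i) = ∑ i, ξ i * B b (column σ i) := by simp
    have e6 : B (∑ i, ξ i • column σ i) b = ∑ i, ξ i * B (column σ i) b := by simp
    rw [e1, e2, ← e3, ← e4, ← e5, ← e6, taylorTwo, eulerIncrement, toLp_mulVec,
      add_sub_cancel_left]
    simp only [map_add, map_smul, add_apply, smul_apply, smul_eq_mul]
    linear_combination (1 / 2 * B (∑ i, ξ i • column σ i) (∑ i, ξ i • column σ i)) * hs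
  simp only [key]
  rw [signAvg_quadratic, Finset.mul_sum]

theorem sum_column_eq (B : Space d →L[ℝ] Space d →L[ℝ] ℝ) (σ : Matrix (Fin d) (Fin d) ℝ) :
    ∑ j, B (column σ j) (column σ j) = ∑ i, ∑ k, (σ * σ.transpose) i k *
      B (EuclideanSpace.single i 1) (EuclideanSpace.single k 1) := by
  have hc : ∀ j, column σ j = ∑ i, σ i j • EuclideanSpace.single i (1 : ℝ) := fun j => by
    ext k; simp [column, Finset.sum_apply, Pi.single_apply]
  simp only [hc, map_sum, map_smul, sum_apply, smul_apply, smul_eq_mul, Matrix.mul_apply,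
    Matrix.transpose_apply, Finset.sum_mul]
  rw [Finset.sum_comm]
  conv_rhs => rw [Finset.sum_comm]
  refine Finset.sum_congr rfl fun i _ => ?_
  simp only [Finset.mul_sum]
  rw [Finset.sum_comm]
  refine Finset.sum_congr rfl fun k _ => Finset.sum_congr rfl fun j _ => by ring

theorem apply_eq_sum (A : Space d →L[ℝ] ℝ) (b : Space d) :
    A b = ∑ i, b i * A (EuclideanSpace.single i 1) := by
  have hv : b = ∑ i, b i • EuclideanSpace.single i (1 : ℝ) := by
    ext j; simp [Finset.sum_apply, Pi.single_apply]
  conv_lhs => rw [hv]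
  simp

/-! ### Local error estimates -/

theorem abs_mul_le_mul_of_le {a b A B : ℝ} (ha : |a| ≤ A) (hb : |b| ≤ B) : |a * b| ≤ A * B := by
  rw [abs_mul]
  exact mul_le_mul ha hb (abs_nonneg _) ((abs_nonneg _).trans ha)

open Classical in
/-- The solution, extended to the exterior of the domain by its Taylor polynomials at the projected
points. -/
def extension (G : Set (Space d)) (π : Space d → Space d) (u : ℝ → Space d → ℝ) (t : ℝ)
    (y : Space d) : ℝ :=
  if y ∈ closure G then u t y else taylorTwo (closure G) (u t) (π y) y

/-- The Taylor polynomials of all functions with derivatives bounded by `M` are compatible. -/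
def TaylorCompatible (S : Set (Space d)) (M C : ℝ) : Prop :=
  ∀ f, DerivBound S M f → ∀ x ∈ S, ∀ z ∈ S, ∀ y,
    |taylorTwo S f z y - taylorTwo S f x y| ≤ C * (‖z - x‖ + ‖y - x‖) ^ 3

theorem abs_extension_sub_taylorTwo_le {G : Set (Space d)} {π : Space d → Space d}
    (hπ : IsBoundaryProjection G π) {u : ℝ → Space d → ℝ} {M C t : ℝ} (hC0 : 0 ≤ C)
    (hC : TaylorCompatible (closure G) M C) (ht : DerivBound (closure G) M (u t)) {x : Space d}
    (hx : x ∈ closure G) (y : Space d) :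
    |extension G π u t y - taylorTwo (closure G) (u t) x y| ≤ 27 * C * ‖y - x‖ ^ 3 := by
  unfold extension
  split_ifs with hy
  · have := hC (u t) ht x hx y hy y
    rw [taylorTwo_self] at this
    refine this.trans ?_
    have h3 : 0 ≤ C * ‖y - x‖ ^ 3 := by positivity
    nlinarith
  · obtain ⟨hz, hd⟩ := hπ y hy
    refine (hC (u t) ht x hx (π y) (frontier_subset_closure hz) y).trans ?_
    have h1 : ‖y - π y‖ ≤ ‖y - x‖ := by
      rw [← dist_eq_norm, hd]; exact infDist_frontier_le hx hy
    have h2 : ‖π y - x‖ ≤ 2 * ‖y - x‖ := by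
      have : π y - x = (y - x) - (y - π y) := by abel
      rw [this]
      linarith [norm_sub_le (y - x) (y - π y)]
    calc C * (‖π y - x‖ + ‖y - x‖) ^ 3 ≤ C * (2 * ‖y - x‖ + ‖y - x‖) ^ 3 := by gcongr
      _ = 27 * C * ‖y - x‖ ^ 3 := by ring

theorem UniformBounds.abs_frozen_sub_generator_le {P : Problem d} {u : ℝ → Space d → ℝ} {M : ℝ}
    (hM : UniformBounds P u M) (hS : UniqueDiffOn ℝ (closure P.G)) {s t : ℝ}
    (hs : s ∈ Icc 0 P.T) (ht : t ∈ Icc 0 P.T) {x : Space d} (hx : x ∈ closure P.G) :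
    |fderivWithin ℝ (u s) (closure P.G) x (P.b t x) +
      1 / 2 * ∑ j, sndDeriv (closure P.G) (u s) x (column (P.σ t x) j) (column (P.σ t x) j) -
        P.generator u s x| ≤ (d * M ^ 2 + d ^ 3 * M ^ 3) * |t - s| := by
  have hM0 : 0 ≤ M := zero_le_one.trans hM.one_le
  set A := fderivWithin ℝ (u s) (closure P.G) x with hA
  set B := sndDeriv (closure P.G) (u s) x with hB
  have hgen : P.generator u s x = (1 / 2) * ∑ i, ∑ k, (P.σ s x * (P.σ s x).transpose) i k *
      B (EuclideanSpace.single i 1) (EuclideanSpace.single k 1) +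
      ∑ i, P.b s x i * A (EuclideanSpace.single i 1) := by
    rw [Problem.generator]
    simp only [iteratedFDerivWithin_two_apply _ hS hx, Matrix.cons_val_zero, Matrix.cons_val_one,
      hA, hB]
  rw [hgen, apply_eq_sum A (P.b t x), sum_column_eq]
  have hA1 : ∀ i, |A (EuclideanSpace.single i 1)| ≤ M := fun i => by
    have := A.le_of_opNorm_le ((hM.deriv s hs).one x hx) (EuclideanSpace.single i (1 : ℝ))
    simpa using this
  have hB1 : ∀ i k, |B (EuclideanSpace.single i 1) (EuclideanSpace.single k 1)| ≤ M := fun i k => by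
    have h1 := B.le_of_opNorm_le ((hM.deriv s hs).two x hx) (EuclideanSpace.single i (1 : ℝ))
    have := (B (EuclideanSpace.single i 1)).le_of_opNorm_le h1 (EuclideanSpace.single k (1 : ℝ))
    simpa using this
  have ha : ∀ i k, |(P.σ t x * (P.σ t x).transpose) i k - (P.σ s x * (P.σ s x).transpose) i k| ≤
      2 * d * M ^ 2 * |t - s| := by
    intro i k
    simp only [Matrix.mul_apply, Matrix.transpose_apply, ← Finset.sum_sub_distrib]
    refine (Finset.abs_sum_le_sum_abs _ _).trans ((Finset.sum_le_sum
      (g := fun _ => 2 * M ^ 2 * |t - s|) fun j _ => ?_).trans_eq (by simp; ring))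
    have e : P.σ t x i j * P.σ t x k j - P.σ s x i j * P.σ s x k j =
      (P.σ t x i j - P.σ s x i j) * P.σ t x k j + P.σ s x i j * (P.σ t x k j - P.σ s x k j) := by
      ring
    rw [e]
    refine (abs_add_le _ _).trans ?_
    have h1 := abs_mul_le_mul_of_le ((hM.σ_bound i j).lipschitz s hs t ht x hx)
      ((hM.σ_bound k j).bound t ht x hx)
    have h2 := abs_mul_le_mul_of_le ((hM.σ_bound i j).bound s hs x hx)
      ((hM.σ_bound k j).lipschitz s hs t ht x hx)
    linarith
  have e1 : ∑ i, P.b t x i * A (EuclideanSpace.single i 1) +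
      1 / 2 * ∑ i, ∑ k, (P.σ t x * (P.σ t x).transpose) i k *
        B (EuclideanSpace.single i 1) (EuclideanSpace.single k 1) -
      (1 / 2 * ∑ i, ∑ k, (P.σ s x * (P.σ s x).transpose) i k *
        B (EuclideanSpace.single i 1) (EuclideanSpace.single k 1) +
        ∑ i, P.b s x i * A (EuclideanSpace.single i 1)) =
      ∑ i, (P.b t x i - P.b s x i) * A (EuclideanSpace.single i 1) +
      1 / 2 * ∑ i, ∑ k, ((P.σ t x * (P.σ t x).transpose) i k -
        (P.σ s x * (P.σ s x).transpose) i k) *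
        B (EuclideanSpace.single i 1) (EuclideanSpace.single k 1) := by
    simp only [sub_mul, Finset.sum_sub_distrib]
    ring
  rw [e1]
  have h1 : |∑ i, (P.b t x i - P.b s x i) * A (EuclideanSpace.single i 1)| ≤
      d * (M * |t - s| * M) := by
    refine (Finset.abs_sum_le_sum_abs _ _).trans ((Finset.sum_le_sum
      (g := fun _ => M * |t - s| * M) fun i _ => ?_).trans_eq (by simp))
    exact abs_mul_le_mul_of_le ((hM.b_bound i).lipschitz s hs t ht x hx) (hA1 i)
  have h2 : |∑ i, ∑ k, ((P.σ t x * (P.σ t x).transpose) i k -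
        (P.σ s x * (P.σ s x).transpose) i k) *
        B (EuclideanSpace.single i 1) (EuclideanSpace.single k 1)| ≤
      d * (d * (2 * d * M ^ 2 * |t - s| * M)) := by
    refine (Finset.abs_sum_le_sum_abs _ _).trans ((Finset.sum_le_sum
      (g := fun _ => d * (2 * d * M ^ 2 * |t - s| * M)) fun i _ => ?_).trans_eq (by simp))
    refine (Finset.abs_sum_le_sum_abs _ _).trans ((Finset.sum_le_sum
      (g := fun _ => 2 * d * M ^ 2 * |t - s| * M) fun k _ => ?_).trans_eq (by simp))
    exact abs_mul_le_mul_of_le (ha i k) (hB1 i k)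
  refine (abs_add_le _ _).trans ?_
  rw [abs_mul, abs_of_pos (by norm_num : (0 : ℝ) < 1 / 2)]
  nlinarith

/-- The conditional expectation of the extended solution after an Euler step. -/
theorem UniformBounds.exists_abs_signAvg_extension_sub_le {P : Problem d} {u : ℝ → Space d → ℝ}
    {M C : ℝ} (hM : UniformBounds P u M) (hS : UniqueDiffOn ℝ (closure P.G)) (hC0 : 0 ≤ C)
    (hC : TaylorCompatible (closure P.G) M C) :
    ∃ K, 0 ≤ K ∧ ∀ h ∈ Ioo (0 : ℝ) 1, ∀ π, IsBoundaryProjection P.G π → ∀ t ∈ Icc 0 P.T,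
      t + h ∈ Icc 0 P.T → ∀ x ∈ closure P.G,
      |signAvg (fun ξ => extension P.G π u (t + h) (x + eulerIncrement h (P.b t x) (P.σ t x) ξ)) -
        u (t + h) x - h * P.generator u (t + h) x| ≤ K * (√h * h) := by
  have hM0 : 0 ≤ M := zero_le_one.trans hM.one_le
  set R := (d + d ^ 2) * M with hR
  have hR0 : 0 ≤ R := by positivity
  refine ⟨27 * C * R ^ 3 + M * (d * M) ^ 2 + (d * M ^ 2 + d ^ 3 * M ^ 3), by positivity, ?_⟩
  intro h hh π hπ t ht hs x hx
  have hh0 := hh.1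
  have hq0 : 0 < √h := Real.sqrt_pos.2 hh.1
  have hq1 : √h ≤ 1 := Real.sqrt_le_one.2 hh.2.le
  have hqh : √h * √h = h := Real.mul_self_sqrt hh.1.le
  have hhq : h * h ≤ √h * h := mul_le_mul_of_nonneg_right (by nlinarith) hh0.le
  set S := closure P.G
  set V := signAvg (fun ξ =>
    extension P.G π u (t + h) (x + eulerIncrement h (P.b t x) (P.σ t x) ξ)) with hV
  have hVT : |V - signAvg (fun ξ => taylorTwo S (u (t + h)) x
      (x + eulerIncrement h (P.b t x) (P.σ t x) ξ))| ≤ 27 * C * R ^ 3 * (√h * h) := by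
    rw [hV, ← signAvg_sub]
    refine abs_signAvg_le fun e => ?_
    refine (abs_extension_sub_taylorTwo_le hπ hC0 hC (hM.deriv _ hs) hx _).trans ?_
    rw [add_sub_cancel_left]
    have := norm_eulerIncrement_le hh (fun i => (hM.b_bound i).bound t ht x hx)
      (fun i j => (hM.σ_bound i j).bound t ht x hx) e
    calc _ ≤ 27 * C * (R * √h) ^ 3 := by gcongr
      _ = 27 * C * R ^ 3 * (√h * (√h * √h)) := by ring
      _ = _ := by rw [hqh]
  rw [signAvg_taylorTwo hh.1.le] at hVT
  have hgen := hM.abs_frozen_sub_generator_le hS hs ht hx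
  have hbb : |sndDeriv S (u (t + h)) x (P.b t x) (P.b t x)| ≤ M * (d * M) ^ 2 := by
    have hb : ‖P.b t x‖ ≤ d * M := (norm_le_sum_abs _).trans ((Finset.sum_le_sum fun i _ =>
      (hM.b_bound i).bound t ht x hx).trans_eq (by simp))
    have h1 := (sndDeriv S (u (t + h)) x).le_of_opNorm_le_of_le ((hM.deriv _ hs).two x hx) hb
    have h2 := (sndDeriv S (u (t + h)) x (P.b t x)).le_of_opNorm_le_of_le h1 hb
    calc _ ≤ M * (d * M) * (d * M) := h2
      _ = _ := by ring
  generalize fderivWithin ℝ (u (t + h)) S x (P.b t x) = A at *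
  generalize sndDeriv S (u (t + h)) x (P.b t x) (P.b t x) = B at *
  generalize ∑ j, sndDeriv S (u (t + h)) x (column (P.σ t x) j) (column (P.σ t x) j) = Q at *
  generalize P.generator u (t + h) x = L at *
  have e : V - u (t + h) x - h * L =
      (V - (u (t + h) x + h * A + 1 / 2 * h ^ 2 * B + 1 / 2 * h * Q)) +
      h * (A + 1 / 2 * Q - L) + 1 / 2 * (h * h) * B := by ring
  have b1 : |h * (A + 1 / 2 * Q - L)| ≤ (d * M ^ 2 + d ^ 3 * M ^ 3) * (√h * h) := by
    refine (abs_mul_le_mul_of_le (abs_of_pos hh0).le hgen).trans ?_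
    rw [sub_add_cancel_left, abs_neg, abs_of_pos hh0]
    calc _ = (d * M ^ 2 + d ^ 3 * M ^ 3) * (h * h) := by ring
      _ ≤ _ := by gcongr
  have b2 : |1 / 2 * (h * h) * B| ≤ M * (d * M) ^ 2 * (√h * h) := by
    refine (abs_mul_le_mul_of_le (A := √h * h) ?_ hbb).trans_eq (by ring)
    rw [abs_of_nonneg (by positivity)]
    nlinarith [mul_pos hh0 hh0]
  rw [e]
  refine (abs_add_three _ _ _).trans ?_
  linarith

/-- The local error of an Euler step. -/
theorem UniformBounds.exists_euler_error {P : Problem d} {ε : ℝ≥0} {ν : Space d → Space d}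
    {u : ℝ → Space d → ℝ} {M C : ℝ} (hM : UniformBounds P u M) (hu : P.IsSolution ε ν u)
    (hS : UniqueDiffOn ℝ (closure P.G)) (hC0 : 0 ≤ C) (hC : TaylorCompatible (closure P.G) M C) :
    ∃ K, 0 ≤ K ∧ ∀ h ∈ Ioo (0 : ℝ) 1, ∀ π, IsBoundaryProjection P.G π → ∀ t ∈ Icc 0 P.T,
      t + h ≤ P.T → ∀ x ∈ closure P.G,
      |signAvg (fun ξ => extension P.G π u (t + h) (x + eulerIncrement h (P.b t x) (P.σ t x) ξ)) *
        (1 + h * P.c t x) + h * P.g t x - u t x| ≤ K * (√h * h) := by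
  have hM0 : 0 ≤ M := zero_le_one.trans hM.one_le
  obtain ⟨K₁, hK₁, hE⟩ := hM.exists_abs_signAvg_extension_sub_le hS hC0 hC
  refine ⟨M * M + M + M * (2 * M + M * M + K₁) + K₁ + M, by positivity, ?_⟩
  intro h hh π hπ t ht hth x hx
  have hs : t + h ∈ Icc 0 P.T := ⟨by linarith [ht.1, hh.1], hth⟩
  have hh0 := hh.1
  have hh1 := hh.2
  have hq0 : 0 < √h := Real.sqrt_pos.2 hh.1
  have hqh : √h * √h = h := Real.mul_self_sqrt hh.1.le
  have hhq1 : h ≤ √h := by nlinarith [Real.sqrt_le_one.2 hh.2.le]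
  have hhq : h * h ≤ √h * h := mul_le_mul_of_nonneg_right hhq1 hh0.le
  replace hE := hE h hh π hπ t ht hs x hx
  have hpde := hu.pde _ hs x hx
  have hc := hM.c_bound.bound t ht x hx
  have hU1 := hM.u_bound.bound _ hs x hx
  have hD := hM.deriv_time _ hs x hx
  have hc' := hM.c_bound.bound _ hs x hx
  have hg' := hM.g_bound.bound _ hs x hx
  have htime := hM.taylor_time x hx (t + h) hs t ht
  have hcl := hM.c_bound.lipschitz (t + h) hs t ht x hx
  have hgl := hM.g_bound.lipschitz (t + h) hs t ht x hx
  rw [sub_add_cancel_left, abs_neg, abs_of_pos hh0] at hcl hgl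
  rw [sub_add_cancel_left, neg_sq] at htime
  generalize signAvg (fun ξ =>
    extension P.G π u (t + h) (x + eulerIncrement h (P.b t x) (P.σ t x) ξ)) = V at *
  generalize u (t + h) x = U at *
  generalize u t x = U₀ at *
  generalize P.generator u (t + h) x = L at *
  generalize derivWithin (fun s => u s x) (Icc 0 P.T) (t + h) = D at *
  generalize P.c (t + h) x = c' at *
  generalize P.g (t + h) x = g' at *
  generalize P.c t x = c at *
  generalize P.g t x = g at *
  have hLle : |L| ≤ 2 * M + M * M := by
    have e : L = -(D + c' * U + g') := by linarith
    rw [e, abs_neg]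
    refine (abs_add_three _ _ _).trans ?_
    have b2 := abs_mul_le_mul_of_le hc' hU1
    linarith
  obtain ⟨E, rfl⟩ : ∃ E, V = U + h * L + E := ⟨V - U - h * L, by ring⟩
  replace hE : |E| ≤ K₁ * (√h * h) := by
    have e : E = U + h * L + E - U - h * L := by ring
    rwa [e]
  have e : (U + h * L + E) * (1 + h * c) + h * g - U₀ =
      (h * ((c - c') * U) + h * (g - g') + h * (c * (h * L + E))) +
        E - (U₀ - U - -h * D) := by
    linear_combination h * hpde
  rw [e]
  have b1 : |h * ((c - c') * U)| ≤ M * M * (√h * h) := by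
    refine (abs_mul_le_mul_of_le (abs_of_pos hh0).le (abs_mul_le_mul_of_le hcl hU1)).trans ?_
    calc h * (M * h * M) = M * M * (h * h) := by ring
      _ ≤ _ := by gcongr
  have b2 : |h * (g - g')| ≤ M * (√h * h) := by
    refine (abs_mul_le_mul_of_le (abs_of_pos hh0).le hgl).trans ?_
    calc h * (M * h) = M * (h * h) := by ring
      _ ≤ _ := by gcongr
  have b3 : |h * (c * (h * L + E))| ≤ M * (2 * M + M * M + K₁) * (√h * h) := by
    have c1 : |h * L + E| ≤ (2 * M + M * M + K₁) * √h := by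
      refine (abs_add_le _ _).trans ?_
      have c2 := abs_mul_le_mul_of_le (abs_of_pos hh0).le hLle
      have c4 : h * (2 * M + M * M) ≤ √h * (2 * M + M * M) := by gcongr
      have c5 : √h * h ≤ √h := mul_le_of_le_one_right hq0.le hh1.le
      have c6 := mul_le_mul_of_nonneg_left c5 hK₁
      linarith
    refine (abs_mul_le_mul_of_le (abs_of_pos hh0).le (abs_mul_le_mul_of_le hc c1)).trans_eq ?_
    ring
  have b4 : M * h ^ 2 ≤ M * (√h * h) := by
    rw [sq]; gcongr
  have b5 := abs_sub ((h * ((c - c') * U) + h * (g - g') + h * (c * (h * L + E))) + E)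
    (U₀ - U - -h * D)
  have b6 := abs_add_le (h * ((c - c') * U) + h * (g - g') + h * (c * (h * L + E))) E
  have b7 := abs_add_three (h * ((c - c') * U)) (h * (g - g')) (h * (c * (h * L + E)))
  linarith

theorem IsInwardUnitNormal.norm_eq_one {G : Set (Space d)} {z v : Space d}
    (h : IsInwardUnitNormal G z v) : ‖v‖ = 1 := by
  obtain ⟨U, ρ, hzU, hρ, rfl⟩ := h
  have := norm_ne_zero_iff.2 (hρ.gradient_ne_zero z hzU)
  simp [norm_smul, this]

/-- The extended solution at an exterior point, in terms of the normal derivatives at its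
projection. -/
theorem UniformBounds.exists_extension_eq {P : Problem d} {ν : Space d → Space d}
    {u : ℝ → Space d → ℝ} {M : ℝ} (hM : UniformBounds P u M)
    (hν : ∀ z ∈ frontier P.G, IsInwardUnitNormal P.G z (ν z)) {π : Space d → Space d}
    (hπ : IsBoundaryProjection P.G π) {t : ℝ} (ht : t ∈ Icc 0 P.T) {y : Space d}
    (hy : y ∉ closure P.G) :
    |fderivWithin ℝ (u t) (closure P.G) (π y) (ν (π y))| ≤ M ∧
    ∃ B, |B| ≤ M ∧ extension P.G π u t y = u t (π y) -
      Metric.infDist y (frontier P.G) *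
        fderivWithin ℝ (u t) (closure P.G) (π y) (ν (π y)) +
      1 / 2 * Metric.infDist y (frontier P.G) ^ 2 * B := by
  obtain ⟨hz, hd⟩ := hπ y hy
  have hzS := frontier_subset_closure hz
  have hn := (hν _ hz).norm_eq_one
  refine ⟨?_, sndDeriv (closure P.G) (u t) (π y) (ν (π y)) (ν (π y)), ?_, ?_⟩
  · have := (fderivWithin ℝ (u t) (closure P.G) (π y)).le_of_opNorm_le
      ((hM.deriv t ht).one _ hzS) (ν (π y))
    simpa [hn] using this
  · have h1 := (sndDeriv (closure P.G) (u t) (π y)).le_of_opNorm_le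
      ((hM.deriv t ht).two _ hzS) (ν (π y))
    have := (sndDeriv (closure P.G) (u t) (π y) (ν (π y))).le_of_opNorm_le h1 (ν (π y))
    simpa [hn] using this
  · rw [extension, if_neg hy, taylorTwo, sub_projection_eq hy hz hd (hν _ hz)]
    simp only [map_smul, smul_apply, smul_eq_mul]
    ring

/-- The local error of a projection step. -/
theorem UniformBounds.exists_projection_error {P : Problem d} {ε : ℝ≥0} {ν : Space d → Space d}
    {u : ℝ → Space d → ℝ} {M : ℝ} (hM : UniformBounds P u M) (hu : P.IsSolution ε ν u)
    (hν : ∀ z ∈ frontier P.G, IsInwardUnitNormal P.G z (ν z)) {R : ℝ} (hR : 0 ≤ R) :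
    ∃ K, 0 ≤ K ∧ ∀ π, IsBoundaryProjection P.G π → ∀ t ∈ Icc 0 P.T, ∀ y ∉ closure P.G, ∀ r,
      r = Metric.infDist y (frontier P.G) → r ≤ R → t + r * P.μ (π y) ≤ P.T →
      |u (t + r * P.μ (π y)) (π y) *
        (1 + r * P.γ t (π y) + r * P.μ (π y) * P.c t (π y)) - r * P.ψ t (π y) +
        r * P.μ (π y) * P.g t (π y) - extension P.G π u t y| ≤ K * r ^ 2 := by
  have hM1 := hM.one_le
  have hM0 : 0 ≤ M := zero_le_one.trans hM1
  refine ⟨(M * M) * (M + M * M) + M * (M * M) * (1 + R * (M + M * M)) + M, by positivity, ?_⟩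
  intro π hπ t ht y hy r hr hrR hT
  obtain ⟨hN, B, hB, hext⟩ := hM.exists_extension_eq hν hπ ht hy
  obtain ⟨hz, -⟩ := hπ y hy
  rw [← hr] at hext
  rw [hext]
  have hr0 : 0 ≤ r := hr ▸ Metric.infDist_nonneg
  generalize π y = z at *
  have hzS := frontier_subset_closure hz
  have hpde := hu.pde t ht z hzS
  have hbd := hu.boundary t ht z hz
  obtain ⟨hμM, hμ1⟩ := hM.μ_bound z hz
  have hμ0 : 0 ≤ P.μ z := by nlinarith
  have hs : t + r * P.μ z ∈ Icc 0 P.T := ⟨by have := ht.1; positivity, hT⟩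
  have htime := hM.taylor_time z hzS t ht _ hs
  have hD := hM.deriv_time t ht z hzS
  have hc := hM.c_bound.bound t ht z hzS
  have hγ := hM.γ_bound t ht z hz
  rw [add_sub_cancel_left] at htime
  generalize u (t + r * P.μ z) z = U' at *
  generalize u t z = U at *
  generalize P.generator u t z = L at *
  generalize derivWithin (fun s => u s z) (Icc 0 P.T) t = D at *
  generalize fderivWithin ℝ (u t) (closure P.G) z (ν z) = N at *
  generalize P.c t z = c at *
  generalize P.g t z = g at *
  generalize P.γ t z = γ at *
  generalize P.ψ t z = ψ at *
  generalize P.μ z = m at *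
  obtain ⟨E, rfl⟩ : ∃ E, U' = U + r * m * D + E := ⟨U' - U - r * m * D, by ring⟩
  have hE : |E| ≤ M * (M * M) * r ^ 2 := by
    have e : E = U + r * m * D + E - U - r * m * D := by ring
    rw [e]
    refine htime.trans ?_
    calc M * (r * m) ^ 2 = M * (m * m) * r ^ 2 := by ring
      _ ≤ _ := by gcongr
  have hw : |γ + m * c| ≤ M + M * M := (abs_add_le _ _).trans (add_le_add hγ
    (abs_mul_le_mul_of_le (by rwa [abs_of_nonneg hμ0]) hc))
  have hw1 : |1 + r * (γ + m * c)| ≤ 1 + R * (M + M * M) := by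
    refine (abs_add_le _ _).trans ?_
    rw [abs_one]
    gcongr
    exact abs_mul_le_mul_of_le (by rwa [abs_of_nonneg hr0]) hw
  have e : (U + r * m * D + E) * (1 + r * γ + r * m * c) - r * ψ + r * m * g -
      (U - r * N + 1 / 2 * r ^ 2 * B) =
      r ^ 2 * ((m * D) * (γ + m * c)) + E * (1 + r * (γ + m * c)) + r ^ 2 * (-(1 / 2) * B) := by
    linear_combination r * m * hpde + r * hbd
  rw [e]
  refine (abs_add_three _ _ _).trans ?_
  have hr2 : |r ^ 2| ≤ r ^ 2 := (abs_of_nonneg (sq_nonneg r)).le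
  have b1 := abs_mul_le_mul_of_le hr2 (abs_mul_le_mul_of_le
    (abs_mul_le_mul_of_le (by rwa [abs_of_nonneg hμ0] : |m| ≤ M) hD) hw)
  have b2 := abs_mul_le_mul_of_le hE hw1
  have b3 := abs_mul_le_mul_of_le hr2 (abs_mul_le_mul_of_le (A := 1)
    (by norm_num [abs_of_pos] : |-(1 / 2 : ℝ)| ≤ 1) hB)
  linarith

/-- The terminal datum is Lipschitz at scale `R` near the domain. -/
def LipschitzNear (S : Set (Space d)) (R L : ℝ) (φ : Space d → ℝ) : Prop :=
  ∀ x ∈ S, ∀ v : Space d, ‖v‖ ≤ R → |φ (x + v) - φ x| ≤ L * ‖v‖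

theorem exists_lipschitzNear {G : Set (Space d)} (hG : Bornology.IsBounded G) {φ : Space d → ℝ}
    (hφ : LocallyLipschitz φ) (R : ℝ) : ∃ L, 0 ≤ L ∧ LipschitzNear (closure G) R L φ := by
  have hc : IsCompact (Metric.cthickening R (closure G)) :=
    hG.isCompact_closure.cthickening
  obtain ⟨K, hK⟩ := (hφ.locallyLipschitzOn (s := Metric.cthickening R (closure G))
    ).exists_lipschitzOnWith_of_compact hc
  refine ⟨K, K.2, fun x hx v hv => ?_⟩
  have h1 : x + v ∈ Metric.cthickening R (closure G) :=
    Metric.mem_cthickening_of_dist_le _ x _ _ hx (by simpa [dist_eq_norm] using hv)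
  have := hK.dist_le_mul _ h1 _ (Metric.self_subset_cthickening _ hx)
  simpa [dist_eq_norm] using this

/-- The error of a final Euler step. -/
theorem UniformBounds.exists_final_euler_error {P : Problem d} {ε : ℝ≥0} {ν : Space d → Space d}
    {u : ℝ → Space d → ℝ} {M : ℝ} (hM : UniformBounds P u M) (hu : P.IsSolution ε ν u)
    {R L : ℝ} (hR : 0 ≤ R) (hL0 : 0 ≤ L) (hL : LipschitzNear (closure P.G) R L P.φ) :
    ∃ K, 0 ≤ K ∧ ∀ h ∈ Ioo (0 : ℝ) 1, ∀ t ∈ Icc 0 P.T, P.T < t + h → ∀ x ∈ closure P.G,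
      ∀ v : Space d, ‖v‖ ≤ R * √h →
      |P.φ (x + v) * (1 + h * P.c t x) + h * P.g t x - u t x| ≤ K * √h := by
  have hM0 : 0 ≤ M := zero_le_one.trans hM.one_le
  refine ⟨L * R + M + M * (M + L * R) + M, by positivity, ?_⟩
  intro h hh t ht hT x hx v hv
  have hh0 := hh.1
  have hq0 : 0 < √h := Real.sqrt_pos.2 hh.1
  have hq1 : √h ≤ 1 := Real.sqrt_le_one.2 hh.2.le
  have hqh : √h * √h = h := Real.mul_self_sqrt hh.1.le
  have hhq1 : h ≤ √h := by nlinarith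
  have hTm : P.T ∈ Icc 0 P.T := ⟨ht.1.trans ht.2, le_rfl⟩
  have hterm := hu.terminal x hx
  have hUT := hM.u_bound.bound _ hTm x hx
  have hlip := hM.u_bound.lipschitz t ht P.T hTm x hx
  have hφ : |P.φ (x + v) - P.φ x| ≤ L * R * √h := by
    refine (hL x hx v (hv.trans (mul_le_of_le_one_right hR hq1))).trans ?_
    rw [mul_assoc]; gcongr
  have hc := hM.c_bound.bound t ht x hx
  have hg := hM.g_bound.bound t ht x hx
  rw [hterm] at hUT hlip
  have hTt : |P.T - t| ≤ √h := by
    rw [abs_of_nonneg (by linarith [ht.2])]; linarith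
  have hF : |P.φ (x + v)| ≤ M + L * R := by
    have e : P.φ (x + v) = P.φ x + (P.φ (x + v) - P.φ x) := by ring
    rw [e]
    have := mul_le_of_le_one_right (by positivity : 0 ≤ L * R) hq1
    linarith [abs_add_le (P.φ x) (P.φ (x + v) - P.φ x)]
  have e : P.φ (x + v) * (1 + h * P.c t x) + h * P.g t x - u t x =
      (P.φ (x + v) - P.φ x) + (P.φ x - u t x) + h * (P.c t x * P.φ (x + v)) + h * P.g t x := by
    ring
  rw [e]
  have hha : |h| ≤ √h := by rwa [abs_of_pos hh0]
  have b1 := abs_mul_le_mul_of_le hha (abs_mul_le_mul_of_le hc hF)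
  have b2 := abs_mul_le_mul_of_le hha hg
  have b3 := mul_le_mul_of_nonneg_left hTt hM0
  have b4 := abs_add_le ((P.φ (x + v) - P.φ x) + (P.φ x - u t x) +
    h * (P.c t x * P.φ (x + v))) (h * P.g t x)
  have b5 := abs_add_three (P.φ (x + v) - P.φ x) (P.φ x - u t x) (h * (P.c t x * P.φ (x + v)))
  linarith

/-- The error of a final projection step. -/
theorem UniformBounds.exists_final_projection_error {P : Problem d} {ε : ℝ≥0}
    {ν : Space d → Space d} {u : ℝ → Space d → ℝ} {M : ℝ} (hM : UniformBounds P u M)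
    (hu : P.IsSolution ε ν u) (hν : ∀ z ∈ frontier P.G, IsInwardUnitNormal P.G z (ν z)) {R : ℝ}
    (hR : 0 ≤ R) :
    ∃ K, 0 ≤ K ∧ ∀ π, IsBoundaryProjection P.G π → ∀ t ∈ Icc 0 P.T, ∀ y ∉ closure P.G, ∀ r,
      r = Metric.infDist y (frontier P.G) → r ≤ R → P.T < t + r * P.μ (π y) →
      |P.φ (π y) * (1 + r * P.γ t (π y) + r * P.μ (π y) * P.c t (π y)) - r * P.ψ t (π y) +
        r * P.μ (π y) * P.g t (π y) - extension P.G π u t y| ≤ K * r := by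
  have hM1 := hM.one_le
  have hM0 : 0 ≤ M := zero_le_one.trans hM1
  refine ⟨M * M + M * (M + M * M) + M + M * M + M + R * M, by positivity, ?_⟩
  intro π hπ t ht y hy r hr hrR hT
  obtain ⟨hN, B, hB, hext⟩ := hM.exists_extension_eq hν hπ ht hy
  obtain ⟨hz, -⟩ := hπ y hy
  rw [← hr] at hext
  rw [hext]
  have hr0 : 0 ≤ r := hr ▸ Metric.infDist_nonneg
  have hra : |r| ≤ r := (abs_of_nonneg hr0).le
  generalize π y = z at *
  have hzS := frontier_subset_closure hz
  obtain ⟨hμM, hμ1⟩ := hM.μ_bound z hz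
  have hμ0 : 0 ≤ P.μ z := by nlinarith
  have hTm : P.T ∈ Icc 0 P.T := ⟨ht.1.trans ht.2, le_rfl⟩
  have hlip := hM.u_bound.lipschitz t ht P.T hTm z hzS
  have hUT := hM.u_bound.bound _ hTm z hzS
  have hc := hM.c_bound.bound t ht z hzS
  have hg := hM.g_bound.bound t ht z hzS
  have hγ := hM.γ_bound t ht z hz
  have hψ := hM.ψ_bound t ht z hz
  rw [hu.terminal z hzS] at hUT hlip
  have hTt : |P.T - t| ≤ r * M := by
    rw [abs_of_nonneg (by linarith [ht.2])]
    have := mul_le_mul_of_nonneg_left hμM hr0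
    linarith
  generalize fderivWithin ℝ (u t) (closure P.G) z (ν z) = N at *
  generalize u t z = U at *
  generalize P.c t z = c at *
  generalize P.g t z = g at *
  generalize P.γ t z = γ at *
  generalize P.ψ t z = ψ at *
  generalize P.φ z = F at *
  generalize P.μ z = m at *
  have hma : |m| ≤ M := by rwa [abs_of_nonneg hμ0]
  have hw : |γ + m * c| ≤ M + M * M := (abs_add_le _ _).trans (add_le_add hγ
    (abs_mul_le_mul_of_le hma hc))
  have e : F * (1 + r * γ + r * m * c) - r * ψ + r * m * g - (U - r * N + 1 / 2 * r ^ 2 * B) =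
      (F - U) + r * (F * (γ + m * c)) + r * (m * g) - r * ψ + r * N - r * (r * (1 / 2 * B)) := by
    ring
  rw [e]
  have b0 := mul_le_mul_of_nonneg_left hTt hM0
  have b1 := abs_mul_le_mul_of_le hra (abs_mul_le_mul_of_le hUT hw)
  have b2 := abs_mul_le_mul_of_le hra (abs_mul_le_mul_of_le hma hg)
  have b3 := abs_mul_le_mul_of_le hra hψ
  have b4 := abs_mul_le_mul_of_le hra hN
  have b5 := abs_mul_le_mul_of_le hra (abs_mul_le_mul_of_le (hra.trans hrR)
    (abs_mul_le_mul_of_le (A := 1) (by norm_num [abs_of_pos] : |(1 / 2 : ℝ)| ≤ 1) hB))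
  have c1 := abs_add_three (F - U) (r * (F * (γ + m * c))) (r * (m * g))
  have c2 := abs_sub ((F - U) + r * (F * (γ + m * c)) + r * (m * g)) (r * ψ)
  have c3 := abs_add_le ((F - U) + r * (F * (γ + m * c)) + r * (m * g) - r * ψ) (r * N)
  have c4 := abs_sub ((F - U) + r * (F * (γ + m * c)) + r * (m * g) - r * ψ + r * N)
    (r * (r * (1 / 2 * B)))
  linarith

/-! ### The steps of the chain -/

open Classical in
/-- One step of the chain. -/
def Problem.step (P : Problem d) (π : Space d → Space d) (h : ℝ) (ξ : Fin d → ℝ)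
    (s : ChainState d) : ChainState d :=
  if s.X ∈ closure P.G then P.eulerStep h ξ s else P.projectionStep π s

theorem Problem.chain_succ (P : Problem d) (π : Space d → Space d) (h t₀ : ℝ) (x : Space d)
    (ξ : ℕ → Fin d → ℝ) (k : ℕ) :
    P.chain π h t₀ x ξ (k + 1) = P.step π h (ξ (k + 1)) (P.chain π h t₀ x ξ k) := rfl

theorem Problem.step_of_mem {P : Problem d} {s : ChainState d} (hs : s.X ∈ closure P.G)
    (π : Space d → Space d) (h : ℝ) (ξ : Fin d → ℝ) : P.step π h ξ s = P.eulerStep h ξ s :=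
  if_pos hs

theorem Problem.step_of_notMem {P : Problem d} {s : ChainState d} (hs : s.X ∉ closure P.G)
    (π : Space d → Space d) (h : ℝ) (ξ : Fin d → ℝ) : P.step π h ξ s = P.projectionStep π s :=
  if_neg hs

open Classical in
/-- The time increment of a step, which does not depend on the noise. -/
def Problem.timeStep (P : Problem d) (π : Space d → Space d) (h : ℝ) (s : ChainState d) : ℝ :=
  if s.X ∈ closure P.G then h else Metric.infDist s.X (frontier P.G) * P.μ (π s.X)

theorem Problem.step_t (P : Problem d) (π : Space d → Space d) (h : ℝ) (ξ : Fin d → ℝ)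
    (s : ChainState d) : (P.step π h ξ s).t = s.t + P.timeStep π h s := by
  by_cases hs : s.X ∈ closure P.G
  · rw [step_of_mem hs, timeStep, if_pos hs, eulerStep]
  · rw [step_of_notMem hs, timeStep, if_neg hs, projectionStep]

theorem Problem.timeStep_nonneg {P : Problem d} {π : Space d → Space d}
    (hμ : ∀ z ∈ frontier P.G, 0 < P.μ z) (hπ : IsBoundaryProjection P.G π) {h : ℝ} (hh : 0 ≤ h)
    (s : ChainState d) : 0 ≤ P.timeStep π h s := by
  unfold timeStep
  split_ifs with hs
  · exact hh
  · exact mul_nonneg Metric.infDist_nonneg (hμ _ (hπ _ hs).1).le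

open Classical in
/-- The remaining time, with a bonus for states in the exterior; it decreases by `h / 2` in
each step. -/
def Problem.potential (P : Problem d) (h : ℝ) (s : ChainState d) : ℝ :=
  P.T - s.t + if s.X ∈ closure P.G then 0 else h / 2

theorem Problem.potential_step_le {P : Problem d} {π : Space d → Space d}
    (hμ : ∀ z ∈ frontier P.G, 0 < P.μ z) (hπ : IsBoundaryProjection P.G π) {h : ℝ} (hh : 0 ≤ h)
    (ξ : Fin d → ℝ) (s : ChainState d) :
    P.potential h (P.step π h ξ s) ≤ P.potential h s - h / 2 := by
  by_cases hs : s.X ∈ closure P.G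
  · rw [potential, potential, step_t, timeStep, if_pos hs, if_pos hs]
    split_ifs <;> linarith
  · have h1 := timeStep_nonneg hμ hπ hh s
    have h2 : (P.step π h ξ s).X ∈ closure P.G := by
      rw [step_of_notMem hs]; exact frontier_subset_closure (hπ _ hs).1
    rw [potential, potential, step_t, if_neg hs, if_pos h2]
    linarith

theorem Problem.lt_of_potential_neg {P : Problem d} {h : ℝ} (hh : 0 ≤ h) {s : ChainState d}
    (hs : P.potential h s < 0) : P.T < s.t := by
  unfold potential at hs
  split_ifs at hs <;> linarith

/-- The value `φ(X) Y + Z` of the output functional. -/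
def Problem.finalValue (P : Problem d) (s : ChainState d) : ℝ := P.φ s.X * s.Y + s.Z

/-- The value predicted by the solution of the boundary value problem. -/
def Problem.value (P : Problem d) (π : Space d → Space d) (u : ℝ → Space d → ℝ)
    (s : ChainState d) : ℝ :=
  extension P.G π u s.t s.X * s.Y + s.Z

/-- A state before the terminal time, in the closed domain or close to it. -/
structure Problem.Valid (P : Problem d) (h R : ℝ) (s : ChainState d) : Prop where
  t_mem : s.t ∈ Icc 0 P.T
  infDist_le : s.X ∉ closure P.G → Metric.infDist s.X (frontier P.G) ≤ R * √h

/-- The estimates on single steps of the chain. -/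
structure StepEstimates (P : Problem d) (u : ℝ → Space d → ℝ) (π : Space d → Space d)
    (h R K : ℝ) : Prop where
  error : ∀ s, P.Valid h R s → s.t + P.timeStep π h s ≤ P.T →
    |signAvg (fun ξ => P.value π u (P.step π h ξ s)) - P.value π u s| ≤
      K * (√h * P.timeStep π h s) * |s.Y|
  final : ∀ s, P.Valid h R s → P.T < s.t + P.timeStep π h s → ∀ e,
    |P.finalValue (P.step π h (signs e) s) - P.value π u s| ≤ K * √h * |s.Y|
  weight : ∀ s, P.Valid h R s → ∀ ξ,
    |(P.step π h ξ s).Y| ≤ Real.exp (K * P.timeStep π h s) * |s.Y|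
  valid : ∀ s, P.Valid h R s → s.t + P.timeStep π h s ≤ P.T → ∀ e,
    P.Valid h R (P.step π h (signs e) s)

theorem UniformBounds.exists_stepEstimates {P : Problem d} {ε : ℝ≥0}
    {ν : Space d → Space d} {u : ℝ → Space d → ℝ} {M : ℝ} (hM : UniformBounds P u M)
    (hP : P.IsAdmissible ε) (hu : P.IsSolution ε ν u)
    (hν : ∀ z ∈ frontier P.G, IsInwardUnitNormal P.G z (ν z)) :
    ∃ R K, 0 ≤ K ∧ ∀ h ∈ Ioo (0 : ℝ) 1, ∀ π, IsBoundaryProjection P.G π →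
      StepEstimates P u π h R K := by
  have hM1 := hM.one_le
  have hM0 : 0 ≤ M := zero_le_one.trans hM1
  have hloc := exists_localDefiningFunction hP.boundary
  have hS := uniqueDiffOn_closure hP.isOpen hloc
  obtain ⟨δ, hδ, hj⟩ := exists_shortlyJoined hP.isOpen hP.isBounded hloc
  obtain ⟨C, hC0, hC⟩ := exists_abs_taylorTwo_sub_le hS
    (closure_mono (interior_maximal subset_closure hP.isOpen)) hδ hj hM0
  set R := (d + d ^ 2) * M with hRdef
  have hR0 : 0 ≤ R := by positivity
  obtain ⟨L, hL0, hL⟩ := exists_lipschitzNear hP.isBounded hP.φ_lipschitz R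
  obtain ⟨K₁, hK₁, h₁⟩ := hM.exists_euler_error hu hS hC0 hC
  obtain ⟨K₂, hK₂, h₂⟩ := hM.exists_projection_error hu hν hR0
  obtain ⟨K₃, hK₃, h₃⟩ := hM.exists_final_euler_error hu hR0 hL0 hL
  obtain ⟨K₄, hK₄, h₄⟩ := hM.exists_final_projection_error hu hν hR0
  refine ⟨R, K₁ + K₂ * R * M + K₃ + K₄ * R + (M * M + M), by positivity, fun h hh π hπ => ?_⟩
  set K := K₁ + K₂ * R * M + K₃ + K₄ * R + (M * M + M) with hK
  have k0 : 0 ≤ K₂ * R * M := by positivity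
  have k0' : 0 ≤ K₄ * R := by positivity
  have k0'' : 0 ≤ M * M := by positivity
  have k1 : K₁ ≤ K := by linarith
  have k2 : K₂ * R * M ≤ K := by linarith
  have k3 : K₃ ≤ K := by linarith
  have k4 : K₄ * R ≤ K := by linarith
  have k5 : M * M + M ≤ K := by linarith
  have hK0 : 0 ≤ K := k0''.trans (by linarith)
  have hh0 := hh.1
  have hq0 : 0 < √h := Real.sqrt_pos.2 hh.1
  have hq1 : √h ≤ 1 := Real.sqrt_le_one.2 hh.2.le
  have hincr : ∀ s : ChainState d, s.t ∈ Icc 0 P.T → s.X ∈ closure P.G → ∀ e,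
      ‖eulerIncrement h (P.b s.t s.X) (P.σ s.t s.X) (signs e)‖ ≤ R * √h := fun s ht hX e =>
    norm_eulerIncrement_le hh (fun i => (hM.b_bound i).bound _ ht _ hX)
      (fun i j => (hM.σ_bound i j).bound _ ht _ hX) e
  have hXe : ∀ (s : ChainState d) ξ, (P.eulerStep h ξ s).X =
      s.X + eulerIncrement h (P.b s.t s.X) (P.σ s.t s.X) ξ := fun s ξ => by
    simp only [Problem.eulerStep, eulerIncrement, add_assoc]
  have hdist : ∀ s : ChainState d, P.Valid h R s → s.X ∉ closure P.G →
      Metric.infDist s.X (frontier P.G) ≤ R := fun s hs hX =>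
    (hs.infDist_le hX).trans (mul_le_of_le_one_right hR0 hq1)
  refine ⟨fun s hs hT => ?_, fun s hs hT e => ?_, fun s hs ξ => ?_, fun s hs hT e => ?_⟩
  · by_cases hX : s.X ∈ closure P.G
    · have hdt : P.timeStep π h s = h := if_pos hX
      rw [hdt] at hT ⊢
      have key := h₁ h hh π hπ s.t hs.t_mem hT s.X hX
      have e1 : ∀ ξ, P.value π u (P.step π h ξ s) =
          extension P.G π u (s.t + h) (s.X + eulerIncrement h (P.b s.t s.X) (P.σ s.t s.X) ξ) *
            ((1 + h * P.c s.t s.X) * s.Y) + (s.Z + h * P.g s.t s.X * s.Y) := fun ξ => by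
        rw [Problem.step_of_mem hX, Problem.value, hXe]
        simp only [Problem.eulerStep]
        ring
      simp only [e1]
      rw [signAvg_add, signAvg_mul_const, signAvg_const, Problem.value, extension, if_pos hX]
      have e2 : ∀ V : ℝ, V * ((1 + h * P.c s.t s.X) * s.Y) + (s.Z + h * P.g s.t s.X * s.Y) -
          (u s.t s.X * s.Y + s.Z) =
          (V * (1 + h * P.c s.t s.X) + h * P.g s.t s.X - u s.t s.X) * s.Y := fun V => by ring
      rw [e2, abs_mul]
      refine mul_le_mul_of_nonneg_right (key.trans ?_) (abs_nonneg _)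
      gcongr
    · set r := Metric.infDist s.X (frontier P.G) with hr
      have hr0 : 0 ≤ r := Metric.infDist_nonneg
      have hdt : P.timeStep π h s = r * P.μ (π s.X) := if_neg hX
      rw [hdt] at hT ⊢
      have key := h₂ π hπ s.t hs.t_mem s.X hX r hr (hdist s hs hX) hT
      have hz := (hπ _ hX).1
      obtain ⟨-, hμ1⟩ := hM.μ_bound _ hz
      have e1 : ∀ ξ, P.value π u (P.step π h ξ s) =
          u (s.t + r * P.μ (π s.X)) (π s.X) * (s.Y + r * P.γ s.t (π s.X) * s.Y +
            r * P.μ (π s.X) * P.c s.t (π s.X) * s.Y) + (s.Z - r * P.ψ s.t (π s.X) * s.Y +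
            r * P.μ (π s.X) * P.g s.t (π s.X) * s.Y) := fun ξ => by
        rw [Problem.step_of_notMem hX, Problem.value, Problem.projectionStep]
        simp only [extension, if_pos (frontier_subset_closure hz), ← hr]
      simp only [e1]
      rw [signAvg_const, Problem.value]
      have e2 : ∀ U V m γ c ψ g : ℝ, U * (s.Y + r * γ * s.Y + r * m * c * s.Y) +
          (s.Z - r * ψ * s.Y + r * m * g * s.Y) - (V * s.Y + s.Z) =
          (U * (1 + r * γ + r * m * c) - r * ψ + r * m * g - V) * s.Y := by
        intros; ring
      rw [e2, abs_mul]
      refine mul_le_mul_of_nonneg_right (key.trans ?_) (abs_nonneg _)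
      calc K₂ * r ^ 2 = K₂ * r * (r * 1) := by ring
        _ ≤ K₂ * (R * √h) * (r * (M * P.μ (π s.X))) := by
          gcongr
          exact hs.infDist_le hX
        _ = K₂ * R * M * (√h * (r * P.μ (π s.X))) := by ring
        _ ≤ _ := by
          have := (hP.μ_pos _ hz).le
          gcongr
  · by_cases hX : s.X ∈ closure P.G
    · have hdt : P.timeStep π h s = h := if_pos hX
      rw [hdt] at hT
      have key := h₃ h hh s.t hs.t_mem hT s.X hX _ (hincr s hs.t_mem hX e)
      rw [Problem.finalValue, Problem.step_of_mem hX, hXe, Problem.value, extension, if_pos hX]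
      simp only [Problem.eulerStep]
      have e2 : ∀ V c g U : ℝ, V * (s.Y + h * c * s.Y) + (s.Z + h * g * s.Y) - (U * s.Y + s.Z) =
          (V * (1 + h * c) + h * g - U) * s.Y := by intros; ring
      rw [e2, abs_mul]
      refine mul_le_mul_of_nonneg_right (key.trans ?_) (abs_nonneg _)
      gcongr
    · set r := Metric.infDist s.X (frontier P.G) with hr
      have hdt : P.timeStep π h s = r * P.μ (π s.X) := if_neg hX
      rw [hdt] at hT
      have key := h₄ π hπ s.t hs.t_mem s.X hX r hr (hdist s hs hX) hT
      rw [Problem.finalValue, Problem.step_of_notMem hX, Problem.value, Problem.projectionStep]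
      simp only [← hr]
      have e2 : ∀ U V m γ c ψ g : ℝ, U * (s.Y + r * γ * s.Y + r * m * c * s.Y) +
          (s.Z - r * ψ * s.Y + r * m * g * s.Y) - (V * s.Y + s.Z) =
          (U * (1 + r * γ + r * m * c) - r * ψ + r * m * g - V) * s.Y := by
        intros; ring
      rw [e2, abs_mul]
      refine mul_le_mul_of_nonneg_right (key.trans ?_) (abs_nonneg _)
      calc K₄ * r ≤ K₄ * (R * √h) := by gcongr; exact hs.infDist_le hX
        _ = K₄ * R * √h := by ring
        _ ≤ _ := by gcongr
  · have hexp : ∀ a w : ℝ, 0 ≤ a → |w| ≤ (M * M + M) * a → |1 + w| ≤ Real.exp (K * a) := by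
      intro a w ha hw
      calc |1 + w| ≤ 1 + |w| := by simpa using abs_add_le 1 w
        _ ≤ K * a + 1 := by nlinarith
        _ ≤ _ := Real.add_one_le_exp _
    by_cases hX : s.X ∈ closure P.G
    · have hdt : P.timeStep π h s = h := if_pos hX
      rw [hdt, Problem.step_of_mem hX]
      have e1 : (P.eulerStep h ξ s).Y = (1 + h * P.c s.t s.X) * s.Y := by
        simp only [Problem.eulerStep]; ring
      rw [e1, abs_mul]
      refine mul_le_mul_of_nonneg_right (hexp h _ hh0.le ?_) (abs_nonneg _)
      have := abs_mul_le_mul_of_le (abs_of_pos hh0).le (hM.c_bound.bound _ hs.t_mem _ hX)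
      nlinarith
    · set r := Metric.infDist s.X (frontier P.G) with hr
      have hr0 : 0 ≤ r := Metric.infDist_nonneg
      have hdt : P.timeStep π h s = r * P.μ (π s.X) := if_neg hX
      rw [hdt, Problem.step_of_notMem hX]
      have hz := (hπ _ hX).1
      have hμ0 := hP.μ_pos _ hz
      obtain ⟨-, hμ1⟩ := hM.μ_bound _ hz
      have e1 : (P.projectionStep π s).Y = (1 + (r * P.γ s.t (π s.X) +
          r * P.μ (π s.X) * P.c s.t (π s.X))) * s.Y := by
        simp only [Problem.projectionStep, ← hr]; ring
      rw [e1, abs_mul]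
      refine mul_le_mul_of_nonneg_right (hexp _ _ (by positivity) ?_) (abs_nonneg _)
      have b1 := abs_mul_le_mul_of_le (abs_of_nonneg hr0).le (hM.γ_bound _ hs.t_mem _ hz)
      have b2 := abs_mul_le_mul_of_le (abs_of_nonneg (mul_nonneg hr0 hμ0.le)).le
        (hM.c_bound.bound _ hs.t_mem _ (frontier_subset_closure hz))
      have b3 : r * M * 1 ≤ r * M * (M * P.μ (π s.X)) := by gcongr
      refine (abs_add_le _ _).trans ?_
      linarith
  · refine ⟨?_, fun hX' => ?_⟩
    · rw [Problem.step_t]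
      exact ⟨add_nonneg hs.t_mem.1 (Problem.timeStep_nonneg hP.μ_pos hπ hh0.le s), hT⟩
    · by_cases hX : s.X ∈ closure P.G
      · refine (infDist_frontier_le hX hX').trans ?_
        rw [Problem.step_of_mem hX, hXe, add_sub_cancel_left]
        exact hincr s hs.t_mem hX e
      · rw [Problem.step_of_notMem hX] at hX'
        exact absurd (frontier_subset_closure (hπ _ hX).1) hX'

/-! ### The expected output -/

open Classical in
/-- The expected output of the chain started at `s`, if it is stopped after at most `n` steps. -/
def Problem.expectedOutput (P : Problem d) (π : Space d → Space d) (h : ℝ) :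
    ℕ → ChainState d → ℝ
  | 0, s => P.finalValue s
  | n + 1, s => if P.T < s.t then P.finalValue s else
      signAvg fun ξ => P.expectedOutput π h n (P.step π h ξ s)

theorem Problem.expectedOutput_of_lt {P : Problem d} {π : Space d → Space d} {h : ℝ} (n : ℕ)
    {s : ChainState d} (hs : P.T < s.t) : P.expectedOutput π h n s = P.finalValue s := by
  cases n with
  | zero => rfl
  | succ n => exact if_pos hs

theorem StepEstimates.abs_expectedOutput_sub_le {P : Problem d} {u : ℝ → Space d → ℝ}
    {π : Space d → Space d} {h R K : ℝ} (hE : StepEstimates P u π h R K) (hK : 0 ≤ K)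
    (hh : 0 < h) (hμ : ∀ z ∈ frontier P.G, 0 < P.μ z) (hπ : IsBoundaryProjection P.G π) (n : ℕ)
    (s : ChainState d) (hs : P.Valid h R s) (hn : P.potential h s < n * (h / 2)) :
    |P.expectedOutput π h n s - P.value π u s| ≤
      √h * |s.Y| * Real.exp (K * (P.T - s.t)) * (K + K * (P.T - s.t)) := by
  induction n generalizing s with
  | zero =>
    exact absurd (Problem.lt_of_potential_neg hh.le (by simpa using hn)) hs.t_mem.2.not_gt
  | succ n ih =>
    have hdt0 := Problem.timeStep_nonneg hμ hπ hh.le s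
    have hrem : 0 ≤ P.T - s.t := sub_nonneg.2 hs.t_mem.2
    have hexp : 1 ≤ Real.exp (K * (P.T - s.t)) := Real.one_le_exp (by positivity)
    have hqY : 0 ≤ √h * |s.Y| := by positivity
    rw [Problem.expectedOutput, if_neg hs.t_mem.2.not_gt]
    rcases lt_or_ge P.T (s.t + P.timeStep π h s) with hT | hT
    · have e : signAvg (fun ξ => P.expectedOutput π h n (P.step π h ξ s)) - P.value π u s =
          signAvg (fun ξ => P.finalValue (P.step π h ξ s) - P.value π u s) := by
        rw [signAvg_sub, signAvg_const]
        congr 2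
        ext ξ
        exact Problem.expectedOutput_of_lt n (by rwa [Problem.step_t])
      rw [e]
      refine (abs_signAvg_le fun e => hE.final s hs hT e).trans ?_
      calc K * √h * |s.Y| = √h * |s.Y| * 1 * (K + 0) := by ring
        _ ≤ _ := by gcongr; positivity
    · have b1 : |signAvg (fun ξ => P.expectedOutput π h n (P.step π h ξ s) -
          P.value π u (P.step π h ξ s))| ≤ √h * |s.Y| * Real.exp (K * (P.T - s.t)) *
            (K + K * (P.T - s.t - P.timeStep π h s)) := by
        refine abs_signAvg_le fun e => ?_
        have hv := hE.valid s hs hT e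
        refine (ih _ hv ?_).trans ?_
        · have := Problem.potential_step_le hμ hπ hh.le (signs e) s
          push_cast at hn
          linarith
        · rw [Problem.step_t]
          have hw := hE.weight s hs (signs e)
          have e1 : Real.exp (K * (P.T - s.t)) = Real.exp (K * P.timeStep π h s) *
              Real.exp (K * (P.T - (s.t + P.timeStep π h s))) := by
            rw [← Real.exp_add]; ring_nf
          have hpos : 0 ≤ K + K * (P.T - (s.t + P.timeStep π h s)) := by
            have : 0 ≤ P.T - (s.t + P.timeStep π h s) := by linarith
            positivity
          calc _ ≤ √h * (Real.exp (K * P.timeStep π h s) * |s.Y|) *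
                Real.exp (K * (P.T - (s.t + P.timeStep π h s))) *
                (K + K * (P.T - (s.t + P.timeStep π h s))) := by gcongr
            _ = _ := by rw [e1]; ring
      have b2 := hE.error s hs hT
      rw [signAvg_sub] at b1
      have b3 := abs_sub_le (signAvg fun ξ => P.expectedOutput π h n (P.step π h ξ s))
        (signAvg fun ξ => P.value π u (P.step π h ξ s)) (P.value π u s)
      have b4 : √h * |s.Y| * 1 * (K * P.timeStep π h s) ≤
          √h * |s.Y| * Real.exp (K * (P.T - s.t)) * (K * P.timeStep π h s) := by gcongr
      nlinarith

/-! ### The output as a function of finitely many signs -/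

open Classical in
/-- The output of the chain started at `s` and driven by `ξ 0, ξ 1, …`, if it is stopped after at
most `n` steps. -/
def Problem.pathOutput (P : Problem d) (π : Space d → Space d) (h : ℝ) :
    ℕ → (ℕ → Fin d → ℝ) → ChainState d → ℝ
  | 0, _, s => P.finalValue s
  | n + 1, ξ, s => if P.T < s.t then P.finalValue s else
      P.pathOutput π h n (fun k => ξ (k + 1)) (P.step π h (ξ 0) s)

theorem Problem.pathOutput_congr (P : Problem d) (π : Space d → Space d) (h : ℝ) (n : ℕ)
    {ξ ξ' : ℕ → Fin d → ℝ} (hξ : ∀ k < n, ξ k = ξ' k) (s : ChainState d) :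
    P.pathOutput π h n ξ s = P.pathOutput π h n ξ' s := by
  induction n generalizing ξ ξ' s with
  | zero => rfl
  | succ n ih =>
    rw [pathOutput, pathOutput, hξ 0 n.succ_pos,
      ih (ξ := fun k => ξ (k + 1)) (ξ' := fun k => ξ' (k + 1)) fun k hk => hξ (k + 1) (by lia)]

theorem Problem.steps_eq {P : Problem d} {π : Space d → Space d} {h t₀ : ℝ} {x : Space d}
    {ξ : ℕ → Fin d → ℝ} {j : ℕ} (hlt : ∀ i < j, (P.chain π h t₀ x ξ i).t ≤ P.T)
    (hj : P.T < (P.chain π h t₀ x ξ j).t) : P.steps π h t₀ x ξ = j := by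
  refine le_antisymm (Nat.sInf_le hj) (le_csInf ⟨j, hj⟩ fun i hi => ?_)
  by_contra! hij
  exact absurd hi (hlt i hij).not_gt

theorem Problem.pathOutput_chain (P : Problem d) (π : Space d → Space d) (h t₀ : ℝ) (x : Space d)
    (ξ : ℕ → Fin d → ℝ) (n j : ℕ) (hlt : ∀ i < j, (P.chain π h t₀ x ξ i).t ≤ P.T)
    (hex : ∃ k ≤ j + n, P.T < (P.chain π h t₀ x ξ k).t) :
    P.pathOutput π h n (fun k => ξ (j + k + 1)) (P.chain π h t₀ x ξ j) =
      P.output π h t₀ x ξ := by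
  induction n generalizing j with
  | zero =>
    obtain ⟨k, hk, hkT⟩ := hex
    obtain rfl : k = j := by
      by_contra hne
      exact absurd (hlt k (by lia)) hkT.not_ge
    rw [pathOutput, output, steps_eq hlt hkT, finalValue]
  | succ n ih =>
    rw [pathOutput]
    split_ifs with hj
    · rw [output, steps_eq hlt hj, finalValue]
    · rw [← ih (j + 1) ?_ ?_, chain_succ]
      · congr 1
        ext k
        congr 1
        lia
      · intro i hi
        rcases Nat.lt_succ_iff_lt_or_eq.1 hi with hi | rfl
        · exact hlt i hi
        · exact not_lt.1 hj
      · obtain ⟨k, hk, hkT⟩ := hex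
        exact ⟨k, by lia, hkT⟩

theorem Problem.potential_chain_le {P : Problem d} {π : Space d → Space d}
    (hμ : ∀ z ∈ frontier P.G, 0 < P.μ z) (hπ : IsBoundaryProjection P.G π) {h : ℝ} (hh : 0 ≤ h)
    (t₀ : ℝ) (x : Space d) (ξ : ℕ → Fin d → ℝ) (k : ℕ) :
    P.potential h (P.chain π h t₀ x ξ k) ≤ P.potential h ⟨t₀, x, 1, 0⟩ - k * (h / 2) := by
  induction k with
  | zero => simp [chain]
  | succ k ih =>
    rw [chain_succ]
    have := potential_step_le hμ hπ hh (ξ (k + 1)) (P.chain π h t₀ x ξ k)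
    push_cast
    linarith

/-- Extension of a finite sequence of sign vectors. -/
def signPath {n : ℕ} (e : Fin n → Fin d → Bool) (k : ℕ) : Fin d → ℝ :=
  if hk : k < n then signs (e ⟨k, hk⟩) else 0

theorem Problem.sum_pathOutput (P : Problem d) (π : Space d → Space d) (h : ℝ) (n : ℕ)
    (s : ChainState d) :
    (∑ e : Fin n → Fin d → Bool, P.pathOutput π h n (signPath e) s) / (2 ^ d) ^ n =
      P.expectedOutput π h n s := by
  induction n generalizing s with
  | zero => simp [pathOutput, expectedOutput]
  | succ n ih =>
    by_cases hs : P.T < s.t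
    · simp only [pathOutput, expectedOutput, if_pos hs]
      simp
    · simp only [pathOutput, expectedOutput, if_neg hs]
      rw [signAvg, ← (Fin.consEquiv fun _ : Fin (n + 1) => Fin d → Bool).sum_comp,
        Fintype.sum_prod_type, pow_succ, ← div_div, Finset.sum_div]
      congr 1
      refine Finset.sum_congr rfl fun e₀ _ => ?_
      rw [← ih]
      congr 1
      refine Finset.sum_congr rfl fun e _ => ?_
      refine P.pathOutput_congr π h n (fun k hk => ?_) _
      rw [signPath, signPath, dif_pos hk, dif_pos (Nat.succ_lt_succ hk)]
      rfl

/-! ### Expectations -/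

section Probability

variable {Ω : Type*} [MeasurableSpace Ω] {Pr : Measure Ω}
  {ξ : ℕ → Fin d → Ω → ℝ}

open Classical in
/-- The signs of `ξ 1, …, ξ n` as Boolean variables. -/
def boolPath (ξ : ℕ → Fin d → Ω → ℝ) (n : ℕ) (ω : Ω) : Fin n → Fin d → Bool :=
  fun k i => decide (ξ (k + 1) i ω = 1)

theorem IsRademacherSequence.ae_eq [IsProbabilityMeasure Pr]
    (hξ : IsRademacherSequence Pr ξ) :
    ∀ᵐ ω ∂Pr, ∀ k i, ξ k i ω = 1 ∨ ξ k i ω = -1 := by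
  rw [ae_all_iff]; intro k
  rw [ae_all_iff]; intro i
  have hm1 : MeasurableSet {ω | ξ k i ω = 1} := hξ.measurable k i (measurableSet_singleton 1)
  have hm2 : MeasurableSet {ω | ξ k i ω = -1} := hξ.measurable k i (measurableSet_singleton (-1))
  have hu : Pr ({ω | ξ k i ω = 1} ∪ {ω | ξ k i ω = -1}) = 1 := by
    rw [measure_union _ hm2, hξ.prob_one, hξ.prob_neg_one, ENNReal.add_halves]
    rw [Set.disjoint_left]
    intro ω h1 h2
    have h1' : ξ k i ω = 1 := h1
    have h2' : ξ k i ω = -1 := h2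
    linarith
  exact (prob_compl_eq_zero_iff (hm1.union hm2)).2 hu

theorem IsRademacherSequence.measurable_boolPath (hξ : IsRademacherSequence Pr ξ) (n : ℕ) :
    Measurable (boolPath ξ n) := by
  refine measurable_pi_lambda _ fun k => measurable_pi_lambda _ fun i => ?_
  refine measurable_to_bool ?_
  have : (fun ω => boolPath ξ n ω k i) ⁻¹' {true} = {ω | ξ (k + 1) i ω = 1} := by
    ext ω; simp [boolPath]
  rw [this]
  exact hξ.measurable _ i (measurableSet_singleton 1)

theorem IsRademacherSequence.ae_signPath [IsProbabilityMeasure Pr]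
    (hξ : IsRademacherSequence Pr ξ) (n : ℕ) :
    ∀ᵐ ω ∂Pr, ∀ k < n, (fun i => ξ (k + 1) i ω) = signPath (boolPath ξ n ω) k := by
  filter_upwards [hξ.ae_eq] with ω hω k hk
  ext i
  rw [signPath, dif_pos hk, signs, boolPath]
  rcases hω (k + 1) i with h | h
  · simp [h]
  · have : ¬ (-1 : ℝ) = 1 := by norm_num
    simp [h, this]

theorem IsRademacherSequence.measure_boolPath [IsProbabilityMeasure Pr]
    (hξ : IsRademacherSequence Pr ξ) (n : ℕ)
    (e : Fin n → Fin d → Bool) : Pr.real (boolPath ξ n ⁻¹' {e}) = ((2 ^ d) ^ n)⁻¹ := by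
  have hind : iIndepFun (fun (q : Fin n × Fin d) => ξ (q.1 + 1) q.2) Pr :=
    hξ.indep.precomp (g := fun q : Fin n × Fin d => ((q.1 : ℕ) + 1, q.2)) (by
      rintro ⟨a, b⟩ ⟨a', b'⟩ h
      simp only [Prod.mk.injEq, add_left_inj] at h
      exact Prod.ext (Fin.ext h.1) h.2)
  have hae : boolPath ξ n ⁻¹' {e} =ᵐ[Pr] ⋂ q ∈ (Finset.univ : Finset (Fin n × Fin d)),
      (fun (q : Fin n × Fin d) => ξ (q.1 + 1) q.2) q ⁻¹' {if e q.1 q.2 then 1 else -1} := by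
    rw [Filter.eventuallyEq_set]
    filter_upwards [hξ.ae_eq] with ω hω
    simp only [mem_preimage, mem_singleton_iff, mem_iInter, Finset.mem_univ, true_imp_iff,
      funext_iff, Prod.forall, boolPath]
    refine forall_congr' fun k => forall_congr' fun i => ?_
    rcases hω (k + 1) i with h | h <;> cases e k i <;> norm_num [h]
  have hval : ∀ q : Fin n × Fin d,
      Pr (ξ (q.1 + 1) q.2 ⁻¹' {if e q.1 q.2 then (1 : ℝ) else -1}) = 1 / 2 := by
    intro q
    split_ifs
    · exact hξ.prob_one _ _
    · exact hξ.prob_neg_one _ _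
  rw [measureReal_def, measure_congr hae, hind.measure_inter_preimage_eq_mul _
    fun _ _ => measurableSet_singleton _]
  simp only [hval]
  simp [pow_mul, mul_comm n d]

theorem IsRademacherSequence.integral_boolPath [IsProbabilityMeasure Pr]
    (hξ : IsRademacherSequence Pr ξ) (n : ℕ)
    (F : (Fin n → Fin d → Bool) → ℝ) :
    Integrable (fun ω => F (boolPath ξ n ω)) Pr ∧
      ∫ ω, F (boolPath ξ n ω) ∂Pr = (∑ e, F e) / (2 ^ d) ^ n := by
  have hm := hξ.measurable_boolPath n
  have hp : IsProbabilityMeasure (Pr.map (boolPath ξ n)) :=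
    Measure.isProbabilityMeasure_map hm.aemeasurable
  have hFi : Integrable F (Pr.map (boolPath ξ n)) := Integrable.of_finite
  refine ⟨hFi.comp_measurable hm, ?_⟩
  rw [← integral_map hm.aemeasurable hFi.aestronglyMeasurable, integral_fintype hFi, Finset.sum_div]
  refine Finset.sum_congr rfl fun e _ => ?_
  rw [map_measureReal_apply hm (measurableSet_singleton e), hξ.measure_boolPath, smul_eq_mul,
    inv_mul_eq_div]

theorem IsRademacherSequence.integral_pathOutput [IsProbabilityMeasure Pr]
    (hξ : IsRademacherSequence Pr ξ) (P : Problem d)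
    (π : Space d → Space d) (h : ℝ) (n : ℕ) (s : ChainState d) :
    Integrable (fun ω => P.pathOutput π h n (fun k i => ξ (k + 1) i ω) s) Pr ∧
      ∫ ω, P.pathOutput π h n (fun k i => ξ (k + 1) i ω) s ∂Pr = P.expectedOutput π h n s := by
  have hae : (fun ω => P.pathOutput π h n (fun k i => ξ (k + 1) i ω) s) =ᵐ[Pr]
      fun ω => P.pathOutput π h n (signPath (boolPath ξ n ω)) s := by
    filter_upwards [hξ.ae_signPath n] with ω hω
    exact P.pathOutput_congr π h n hω s
  obtain ⟨hi, heq⟩ := hξ.integral_boolPath n fun e => P.pathOutput π h n (signPath e) s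
  exact ⟨hi.congr hae.symm, by rw [integral_congr_ae hae, heq, P.sum_pathOutput]⟩

end Probability

end StickyEuler

end

theorem mainTheorem2 {d : ℕ} (P : StickyEuler.Problem d) (ε : ℝ≥0) (hε : 0 < ε ∧ ε < 1)
    (hP : P.IsAdmissible ε)
    (ν : StickyEuler.Space d → StickyEuler.Space d)
    (hν : ∀ z ∈ frontier P.G, StickyEuler.IsInwardUnitNormal P.G z (ν z))
    (u : ℝ → StickyEuler.Space d → ℝ) (hu : P.IsSolution ε ν u)
    (t₀ : ℝ) (ht₀ : t₀ ∈ Set.Ico 0 P.T) (x : StickyEuler.Space d) (hx : x ∈ P.G) :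
    ∃ C : ℝ, 0 < C ∧ ∀ h ∈ Set.Ioo (0 : ℝ) 1,
      ∀ π : StickyEuler.Space d → StickyEuler.Space d, StickyEuler.IsBoundaryProjection P.G π →
      ∀ (Ω : Type*) [MeasurableSpace Ω] (Pr : Measure Ω) [IsProbabilityMeasure Pr]
        (ξ : ℕ → Fin d → Ω → ℝ), StickyEuler.IsRademacherSequence Pr ξ →
        (∀ ω, ∃ k, P.T < (P.chain π h t₀ x (fun k i => ξ k i ω) k).t) ∧
        Integrable (fun ω => P.output π h t₀ x (fun k i => ξ k i ω)) Pr ∧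
        |(∫ ω, P.output π h t₀ x (fun k i => ξ k i ω) ∂Pr) - u t₀ x| ≤ C * h ^ (1 / 2 : ℝ) := by
  obtain ⟨M, hM⟩ := hu.exists_uniformBounds hP
  obtain ⟨R, K, hK, hE⟩ := hM.exists_stepEstimates hP hu hν
  have hrem : 0 ≤ P.T - t₀ := sub_nonneg.2 ht₀.2.le
  refine ⟨Real.exp (K * (P.T - t₀)) * (K + K * (P.T - t₀)) + 1, by positivity, ?_⟩
  intro h hh π hπ Ω _ Pr _ ξ hξ
  have hh0 := hh.1
  set s₀ : StickyEuler.ChainState d := ⟨t₀, x, 1, 0⟩ with hs₀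
  obtain ⟨N, hN⟩ := exists_nat_gt (P.potential h s₀ / (h / 2))
  rw [div_lt_iff₀ (by positivity)] at hN
  have hend : ∀ ζ : ℕ → Fin d → ℝ, P.T < (P.chain π h t₀ x ζ N).t := fun ζ =>
    StickyEuler.Problem.lt_of_potential_neg hh0.le
      (by linarith [StickyEuler.Problem.potential_chain_le hP.μ_pos hπ hh0.le t₀ x ζ N])
  have hxS : x ∈ closure P.G := subset_closure hx
  have hvalid : P.Valid h R s₀ := ⟨⟨ht₀.1, ht₀.2.le⟩, fun hX => absurd hxS hX⟩
  have hout : ∀ ω, P.output π h t₀ x (fun k i => ξ k i ω) =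
      P.pathOutput π h N (fun k i => ξ (k + 1) i ω) s₀ := fun ω => by
    rw [← P.pathOutput_chain π h t₀ x _ N 0 (by simp) ⟨N, by simp, hend _⟩]
    simp only [zero_add]
    rfl
  obtain ⟨hi, heq⟩ := hξ.integral_pathOutput P π h N s₀
  simp only [hout]
  refine ⟨fun ω => ⟨N, hend _⟩, hi, ?_⟩
  have key := (hE h hh π hπ).abs_expectedOutput_sub_le hK hh0 hP.μ_pos hπ N s₀ hvalid hN
  have hval : P.value π u s₀ = u t₀ x := by
    simp [StickyEuler.Problem.value, StickyEuler.extension, hs₀, hxS]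
  rw [hval] at key
  rw [heq, ← Real.sqrt_eq_rpow]
  refine key.trans ?_
  simp only [hs₀, abs_one, mul_one]
  nlinarith [Real.sqrt_nonneg h]
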